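/- Let $M^m$ be a smooth $m$-manifold and let $f\colon M^m\to\mathbb R^{m+1}$ be a wave front, i.e. a $C^\infty$ map such that every point has a neighbourhood carrying a smooth unit normal vector field $\nu$ along $f$ (so $|\nu|=1$ and $\langle df(X),\nu\rangle=0$ for all tangent vectors $X$) for which $(f,\nu)$ is an immersion into the unit tangent bundle $\mathbb R^{m+1}\times S^m$. Let $\Sigma_f$ be the set of points where $df$ is not injective. In local coordinates $(u_1,\dots,u_m)$ put $\lambda=\det(f_{u_1},\dots,f_{u_m},\nu)$, so that locally $\Sigma_f=\{\lambda=0\}$. A point $p\in\Sigma_f$ is an $A_2$-point if $d\lambda_p\neq0$ (so that $\Sigma_f$ is a smooth hypersurface near $p$ with $T_p\Sigma_f=\ker d\lambda_p$, and $\ker df_p$ is a line) and $\ker df_p$ is transversal to $T_p\Sigma_f$. The second fundamental form is $II(X,Y)=-\langle df(X),d\nu(Y)\rangle$ (well defined up to sign near an $A_2$-point). Near an $A_2$-point $p$ take smooth vector fields $e_1,\dots,e_{m-1}$, orthonormal for $ds^2=\langle df,df\rangle$ and tangent to $\Sigma_f$ along $\Sigma_f$, and let $\mathbf n$ be the smooth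 unit vector field along $f$ such that $(df(e_1),\dots,df(e_{m-1}),\mathbf n)$ is an orthonormal frame of $\nu^\perp$ with $\det(df(e_1),\dots,df(e_{m-1}),\mathbf n,\nu)>0$. Let $\eta\in\ker df_p$ be such that $(e_1,\dots,e_{m-1},\eta)$ is positively oriented in the coordinates $(u_1,\dots,u_m)$. The singular shape operator $S\colon T_p\Sigma_f\to T_p\Sigma_f$ is given by $$df(S(X))=-\operatorname{sgn}\bigl(d\lambda(\eta)\bigr)\,D_X\mathbf n ,$$ where $D_X\mathbf n$ is the component orthogonal to $\nu$ of the derivative of $\mathbf n$ in the direction $X$; $S$ does not depend on the choices made. The singular principal curvatures of $f$ at $p$ are the eigenvalues of $S$. Let $U\subset M^m$ be an open set such that every point of $U\cap\Sigma_f$ is an $A_2$-point, and let $K$ be the sectional curvature of the induced metric $ds^2$ on $U\setminus\Sigma_f$. Then: 1. If $K$ is bounded on $U\setminus\Sigma_f$ (there is a constant $C$ with $|K|\le C$ for all tangent planes at all points of $U\setminus\Sigma_f$), then $II$ vanishes at every point of $U\cap\Sigma_f$. 2. If $K\ge 0$ on $U\setminus\Sigma_f$ (for all tangent planes), then $K$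 is locally bounded, i.e. each point $p\in U$ has a neighbourhood $V$ such that $K$ is bounded on $(V\cap U)\setminus\Sigma_f$, and all singular principal curvatures of $f$ at the points of $U\cap\Sigma_f$ are non-positive. -/

import Mathlib

open Set Filter Topology Manifold
open scoped ContDiff Manifold

noncomputable section

namespace WaveFront

/-- Euclidean space `ℝⁿ`. -/
abbrev Euc (n : ℕ) : Type := EuclideanSpace ℝ (Fin n)

/-! ### Riemannian curvature in coordinates

`g` is the matrix of a metric on (an open subset of) `ℝᵐ`. -/

section Coordinates

variable {m : ℕ}

/-- The `i`-th partial derivative of a function of `m` variables. -/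
def pd {E : Type*} [NormedAddCommGroup E] [NormedSpace ℝ E]
    (i : Fin m) (h : Euc m → E) (u : Euc m) : E :=
  fderiv ℝ h u (EuclideanSpace.single i 1)

/-- The Christoffel symbol `Γᵏᵢⱼ` of the Levi-Civita connection of `g`. -/
def christoffel (g : Euc m → Matrix (Fin m) (Fin m) ℝ) (k i j : Fin m) (u : Euc m) : ℝ :=
  (1 / 2) * ∑ l, (g u)⁻¹ k l *
    (pd i (fun v => g v j l) u + pd j (fun v => g v i l) u - pd l (fun v => g v i j) u)

/-- The component `Rˡₖᵢⱼ` of the curvature tensor, where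
`R(X, Y) Z = ∇_X ∇_Y Z - ∇_Y ∇_X Z - ∇_[X,Y] Z` and `R(∂ᵢ, ∂ⱼ) ∂ₖ = ∑ₗ Rˡₖᵢⱼ ∂ₗ`. -/
def riemann (g : Euc m → Matrix (Fin m) (Fin m) ℝ) (l k i j : Fin m) (u : Euc m) : ℝ :=
  pd i (christoffel g l j k) u - pd j (christoffel g l i k) u
    + ∑ s, (christoffel g s j k u * christoffel g l i s u
        - christoffel g s i k u * christoffel g l j s u)

/-- The value `g(X, Y)` at `u`. -/
def metricApply (g : Euc m → Matrix (Fin m) (Fin m) ℝ) (u X Y : Euc m) : ℝ :=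
  ∑ i, ∑ j, g u i j * X i * Y j

/-- The sectional curvature at `u` of the plane spanned by `X` and `Y`:
`g(R(X, Y) Y, X) / (g(X, X) g(Y, Y) - g(X, Y)²)`. -/
def sectional (g : Euc m → Matrix (Fin m) (Fin m) ℝ) (u X Y : Euc m) : ℝ :=
  (∑ i, ∑ j, ∑ k, ∑ l, ∑ s, g u l s * riemann g l k i j u * X i * Y j * Y k * X s) /
    (metricApply g u X X * metricApply g u Y Y - metricApply g u X Y ^ 2)

/-- The matrix of the first fundamental form of a map `F` from `ℝᵐ` to `ℝᵐ⁺¹`. -/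
def firstFormMatrix (F : Euc m → Euc (m + 1)) (u : Euc m) : Matrix (Fin m) (Fin m) ℝ :=
  Matrix.of fun i j => inner ℝ (pd i F u) (pd j F u)

/-- The determinant of `n` vectors of `ℝⁿ`. -/
def vecDet {n : ℕ} (v : Fin n → Euc n) : ℝ :=
  Matrix.det (Matrix.of fun i j => v i j)

/-- The volume form `μ(v₁, …, vₘ) = det(v₁, …, vₘ, ν)` on the hyperplane `ν^⊥` that corresponds
to the co-orientation given by the unit vector `ν`. -/
def coorientForm (ν : Euc (m + 1)) (v : Fin m → Euc (m + 1)) : ℝ :=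
  vecDet (Fin.snoc (α := fun _ => Euc (m + 1)) v ν)

/-- The `m`-tuple `(e₁, …, eₘ₋₁, x)`. -/
def snocFrame {V : Type*} (e : Fin (m - 1) → V) (x : V) : Fin m → V :=
  fun i => if h : (i : ℕ) < m - 1 then e ⟨i, h⟩ else x

/-- The signed Jacobian function `λ = μ(∂₁F, …, ∂ₘF)`, where `N` is a unit normal along `F`. -/
def jacobian (F N : Euc m → Euc (m + 1)) (u : Euc m) : ℝ :=
  coorientForm (N u) fun j => pd j F u

/-- The tangent space at a non-degenerate singular point `u` of the singular set `{λ = 0}`. -/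
def singularTangent (F N : Euc m → Euc (m + 1)) (u : Euc m) : Submodule ℝ (Euc m) :=
  LinearMap.ker (fderiv ℝ (jacobian F N) u : Euc m →ₗ[ℝ] ℝ)

/-- `e₁, …, eₘ₋₁` are smooth vector fields on `W`, orthonormal for the first fundamental form and
tangent to the singular set along the singular set, and `n` is the conormal vector field: the
smooth section over `W` of the bundle `N^⊥` for which `(dF(e₁), …, dF(eₘ₋₁), n)` is a positively
oriented orthonormal frame of that bundle. -/
structure IsConormalFrame (F N : Euc m → Euc (m + 1)) (W : Set (Euc m))
    (e : Fin (m - 1) → Euc m → Euc m) (n : Euc m → Euc (m + 1)) : Prop where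
  smooth_e : ∀ i, ContDiffOn ℝ ∞ (e i) W
  smooth_n : ContDiffOn ℝ ∞ n W
  tangent_e : ∀ i, ∀ u ∈ W, jacobian F N u = 0 → e i u ∈ singularTangent F N u
  orthonormal_e : ∀ u ∈ W, Orthonormal ℝ fun i => fderiv ℝ F u (e i u)
  norm_n : ∀ u ∈ W, ‖n u‖ = 1
  inner_n_normal : ∀ u ∈ W, inner ℝ (n u) (N u) = 0
  inner_n_e : ∀ u ∈ W, ∀ i, inner ℝ (n u) (fderiv ℝ F u (e i u)) = 0
  positive : ∀ u ∈ W,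
    0 < coorientForm (N u) (snocFrame (fun i => fderiv ℝ F u (e i u)) (n u))

/-- The connection of the bundle `N^⊥`: the derivative of the section `n` in the direction `X`,
projected orthogonally to `N^⊥`. -/
def tangentialDeriv (N n : Euc m → Euc (m + 1)) (u X : Euc m) : Euc (m + 1) :=
  fderiv ℝ n u X - inner ℝ (fderiv ℝ n u X) (N u) • N u

/-- `S` is the singular shape operator at `u` of the map `F` with unit normal `N` on the open
neighbourhood `W` of `u`: the endomorphism of the tangent space of the singular set with
`dF(S X) = - sgn(dλ(η)) D_X n`, where `η` is a null vector for which `(e₁, …, eₘ₋₁, η)` is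
positively oriented. -/
def IsSingularShapeOperator (F N : Euc m → Euc (m + 1)) (W : Set (Euc m)) (u : Euc m)
    (S : Module.End ℝ (singularTangent F N u)) : Prop :=
  ∃ (e : Fin (m - 1) → Euc m → Euc m) (n : Euc m → Euc (m + 1)) (η : Euc m),
    IsConormalFrame F N W e n ∧
    fderiv ℝ F u η = 0 ∧
    0 < vecDet (snocFrame (fun i => e i u) η) ∧
    ∀ X : singularTangent F N u,
      fderiv ℝ F u (S X : Euc m) =
        -(Real.sign (fderiv ℝ (jacobian F N) u η) • tangentialDeriv N n u (X : Euc m))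

end Coordinates

/-! ### Wave fronts on manifolds

The tangent space of `M` at `p` is, by definition, the space of coordinate vectors in the
preferred chart at `p`; the coordinate notions above are applied in that chart. -/

section Manifolds

variable {m : ℕ} {M : Type*} [TopologicalSpace M] [ChartedSpace (Euc m) M]

/-- A map `h` on `M` read in the preferred chart at `p`. -/
def chartRep (h : M → Euc (m + 1)) (p : M) : Euc m → Euc (m + 1) :=
  h ∘ (extChartAt (𝓡 m) p).symm

/-- The coordinates of `p` in the preferred chart at `p`. -/
def coordAt (p : M) : Euc m := extChartAt (𝓡 m) p p

/-- The differential at `p` of a map from `M` to `ℝᵐ⁺¹`. -/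
def differential (h : M → Euc (m + 1)) (p : M) : TangentSpace (𝓡 m) p →L[ℝ] Euc (m + 1) :=
  mfderiv (𝓡 m) 𝓘(ℝ, Euc (m + 1)) h p

/-- `ν` is a smooth unit normal vector field along `f` on `V`. -/
structure IsUnitNormalOn (f ν : M → Euc (m + 1)) (V : Set M) : Prop where
  smooth : ContMDiffOn (𝓡 m) 𝓘(ℝ, Euc (m + 1)) ∞ ν V
  norm_eq : ∀ q ∈ V, ‖ν q‖ = 1
  normal : ∀ q ∈ V, ∀ X : TangentSpace (𝓡 m) q, inner ℝ (differential f q X) (ν q) = 0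

/-- `f` is a wave front: a smooth map which locally has a smooth unit normal vector field `ν` such
that `(f, ν)`, as a map to the unit tangent bundle `ℝᵐ⁺¹ × Sᵐ`, is an immersion. -/
def IsWaveFront (f : M → Euc (m + 1)) : Prop :=
  ContMDiff (𝓡 m) 𝓘(ℝ, Euc (m + 1)) ∞ f ∧
    ∀ p : M, ∃ (V : Set M) (ν : M → Euc (m + 1)), IsOpen V ∧ p ∈ V ∧ IsUnitNormalOn f ν V ∧
      ∀ q ∈ V, Function.Injective
        (mfderiv (𝓡 m) 𝓘(ℝ, Euc (m + 1) × Euc (m + 1)) (fun x => (f x, ν x)) q)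

/-- The singular set of `f`: the points where `f` is not an immersion. -/
def singularSet (f : M → Euc (m + 1)) : Set M :=
  {p | ¬ Function.Injective (differential f p)}

/-- `p` is an `A₂`-point of `f`: a singular point which is non-degenerate (`dλ ≠ 0`) and at which
the null direction is transversal to the singular submanifold. -/
def IsA2Point (f : M → Euc (m + 1)) (p : M) : Prop :=
  p ∈ singularSet f ∧
    ∃ (V : Set M) (ν : M → Euc (m + 1)), IsOpen V ∧ p ∈ V ∧ IsUnitNormalOn f ν V ∧
      fderiv ℝ (jacobian (chartRep f p) (chartRep ν p)) (coordAt p) ≠ 0 ∧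
      LinearMap.ker (fderiv ℝ (chartRep f p) (coordAt p) : Euc m →ₗ[ℝ] Euc (m + 1)) ⊔
        singularTangent (chartRep f p) (chartRep ν p) (coordAt p) = ⊤

/-- The sectional curvature, at the regular point `q` of `f`, of the metric induced by `f`, for the
plane spanned by the linearly independent tangent vectors `X` and `Y`. -/
def sectionalCurvature (f : M → Euc (m + 1)) (q : M) (X Y : TangentSpace (𝓡 m) q) : ℝ :=
  sectional (firstFormMatrix (chartRep f q)) (coordAt q) X Y

/-- The second fundamental form `II(X, Y) = -⟨df(X), dν(Y)⟩` with respect to the unit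
normal vector field `ν`. -/
def secondForm (f ν : M → Euc (m + 1)) (p : M) (X Y : TangentSpace (𝓡 m) p) : ℝ :=
  -inner ℝ (differential f p X) (differential ν p Y)

/-- `κ` is a singular principal curvature of `f` at the `A₂`-point `p`: an eigenvalue of the
singular shape operator. -/
def IsSingularPrincipalCurvature (f : M → Euc (m + 1)) (p : M) (κ : ℝ) : Prop :=
  ∃ (V : Set M) (ν : M → Euc (m + 1)), IsOpen V ∧ p ∈ V ∧ IsUnitNormalOn f ν V ∧
    ∃ W : Set (Euc m), IsOpen W ∧ coordAt p ∈ W ∧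
      W ⊆ (extChartAt (𝓡 m) p).target ∩ (extChartAt (𝓡 m) p).symm ⁻¹' V ∧
      ∃ S : Module.End ℝ (singularTangent (chartRep f p) (chartRep ν p) (coordAt p)),
        IsSingularShapeOperator (chartRep f p) (chartRep ν p) W (coordAt p) S ∧
        S.HasEigenvalue κ

end Manifolds

end WaveFront

end

/-! Write F for f read in a chart, and let η be a null vector at an A₂-point, so dλ(η) ≠ 0. By the
Gauss equation, K(X, Y) is the quotient of II(X, X) II(Y, Y) - II(X, Y)² (`curvNum`) by the Gram
determinant of dF(X), dF(Y) (`gramDet`). Both stay smooth across the singular set, so bounds on K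
become inequalities that can be differentiated at singular points.

Vanishing of II (`IsCuspidal.sff_eq_zero`). If K ≥ -C, then `curvNum` + C `gramDet`, evaluated on
(X, η) along the line in direction η, is non-negative and vanishes at the A₂-point, so its
derivative there is zero. The Gram determinant has a minimum there as well; what is left is II(X, X)
· ∂_η II(η, η) = 0. The second factor is -⟨F_ηη, dν(η)⟩, non-zero by the front condition
(`inner_fderiv_null_ne_zero`). Only a lower bound on K enters, so the argument serves both claims.

Boundedness (`IsCuspidal.exists_abs_curvNum_le`). Once II vanishes on the singular set, II = O(λ). A
field ξ with dF(ξ) = λφ, φ transversal to the image of dF at the point, gives a splitting X = X' +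
aξ in which |X'| and |aλ| are O(|dF(X)|). In the Gauss numerator the terms of too high order in a
cancel, which leaves O(|dF(X)|² |dF(Y)|²); Gram-Schmidt replaces this by O(`gramDet`).

Sign (`IsCuspidal.singular_curvature_nonpos`). Since II = 0, dν(η) = c 𝐧 with c ≠ 0. If K ≥ 0, then
II(X, X) II(η, η) ≥ 0 along the line; both factors vanish at the point, so the product of their
derivatives is non-negative. For X tangent to the singular set these are -c⟨dF(X), D_X 𝐧⟩ and
-c⟨F_ηη, 𝐧⟩, and ⟨F_ηη, 𝐧⟩ has the sign of dλ(η). For an eigenvector X this says κ ≤ 0. -/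

namespace WaveFront

/-! ### Determinants and the volume form of the hyperplane ν^⊥. -/

section Determinants

variable {m : ℕ}

theorem vecDet_ne_zero_iff {n : ℕ} (v : Fin n → Euc n) :
    vecDet v ≠ 0 ↔ LinearIndependent ℝ v := by
  rw [vecDet, ← isUnit_iff_ne_zero, ← Matrix.isUnit_iff_isUnit_det,
    ← Matrix.linearIndependent_rows_iff_isUnit]
  exact LinearMap.linearIndependent_iff
    (WithLp.linearEquiv 2 ℝ (Fin n → ℝ)).toLinearMap (LinearEquiv.ker _)

/-- The determinant of `n` vectors of `ℝⁿ` as a continuous multilinear map. -/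
noncomputable def vecDetMultilinear (n : ℕ) :
    ContinuousMultilinearMap ℝ (fun _ : Fin n => Euc n) ℝ where
  toMultilinearMap := (Matrix.detRowAlternating (R := ℝ) (n := Fin n)).toMultilinearMap.compLinearMap
    fun _ => (WithLp.linearEquiv 2 ℝ (Fin n → ℝ)).toLinearMap
  cont := by
    change Continuous fun v : Fin n → Euc n => Matrix.det (Matrix.of fun i j => v i j)
    refine Continuous.matrix_det ?_
    refine continuous_matrix fun i j => ?_
    simp only [Matrix.of_apply]
    fun_prop

theorem vecDetMultilinear_apply {n : ℕ} (v : Fin n → Euc n) :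
    vecDetMultilinear n v = vecDet v := rfl

/-- The form `coorientForm ν` as an alternating map. -/
noncomputable def coorientAlternating (ν : Euc (m + 1)) : (Euc (m + 1)) [⋀^Fin m]→ₗ[ℝ] ℝ where
  toFun := coorientForm ν
  map_update_add' := by
    intro inst v i x y
    obtain rfl : inst = instDecidableEqFin m := Subsingleton.elim _ _
    simp only [coorientForm, Fin.snoc_update, ← vecDetMultilinear_apply]
    exact (vecDetMultilinear (m + 1)).map_update_add _ _ _ _
  map_update_smul' := by
    intro inst v i c x
    obtain rfl : inst = instDecidableEqFin m := Subsingleton.elim _ _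
    simp only [coorientForm, Fin.snoc_update, ← vecDetMultilinear_apply]
    exact (vecDetMultilinear (m + 1)).map_update_smul _ _ _ _
  map_eq_zero_of_eq' := by
    intro v i j hv hij
    simp only [coorientForm, vecDet]
    refine Matrix.det_zero_of_row_eq (i := i.castSucc) (j := j.castSucc) (by simpa using hij) ?_
    ext k
    simp [hv]

theorem coorientAlternating_apply (ν : Euc (m + 1)) (v : Fin m → Euc (m + 1)) :
    coorientAlternating ν v = coorientForm ν v := rfl

theorem coorientForm_ne_zero_iff {ν : Euc (m + 1)} (hν : ‖ν‖ = 1) {v : Fin m → Euc (m + 1)}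
    (hv : ∀ i, inner ℝ (v i) ν = 0) : coorientForm ν v ≠ 0 ↔ LinearIndependent ℝ v := by
  rw [coorientForm, vecDet_ne_zero_iff, linearIndependent_finSnoc]
  refine ⟨fun h => h.1, fun h => ⟨h, fun hmem => ?_⟩⟩
  have : ∀ x ∈ Submodule.span ℝ (Set.range v), inner ℝ x ν = 0 := by
    intro x hx
    induction hx using Submodule.span_induction with
    | mem x hx => obtain ⟨i, rfl⟩ := hx; exact hv i
    | zero => simp
    | add x y _ _ hx hy => rw [inner_add_left, hx, hy, add_zero]
    | smul a x _ hx => rw [inner_smul_left, hx, mul_zero]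
  have h0 := this ν hmem
  rw [real_inner_self_eq_norm_sq, hν] at h0
  norm_num at h0

theorem eq_zero_of_inner_eq_zero {ν : Euc (m + 1)} {v : Fin m → Euc (m + 1)}
    (hdet : coorientForm ν v ≠ 0) {z : Euc (m + 1)} (hv : ∀ i, inner ℝ z (v i) = 0)
    (hν : inner ℝ z ν = 0) : z = 0 := by
  rw [coorientForm, vecDet_ne_zero_iff] at hdet
  have hspan := hdet.span_eq_top_of_card_eq_finrank (by simp)
  have hz : ∀ x ∈ Submodule.span ℝ (Set.range (Fin.snoc (α := fun _ => Euc (m + 1)) v ν)),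
      inner ℝ z x = 0 := by
    intro x hx
    induction hx using Submodule.span_induction with
    | mem x hx =>
      obtain ⟨i, rfl⟩ := hx
      refine Fin.lastCases ?_ (fun j => ?_) i
      · simpa using hν
      · simpa using hv j
    | zero => simp
    | add x y _ _ hx hy => rw [inner_add_right, hx, hy, add_zero]
    | smul a x _ hx => rw [inner_smul_right, hx, mul_zero]
  rw [hspan] at hz
  exact inner_self_eq_zero.1 (hz z trivial)

/-- An alternating form of top degree on ℝᵐ is a multiple of the determinant, and the pullback of
the volume form by L is such a form. -/
theorem coorientForm_map (ν : Euc (m + 1)) (L : Euc m →ₗ[ℝ] Euc (m + 1)) (b : Fin m → Euc m) :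
    coorientForm ν (fun j => L (b j)) =
      vecDet b * coorientForm ν fun j => L (EuclideanSpace.single j 1) := by
  have h := AlternatingMap.eq_smul_basis_det (EuclideanSpace.basisFun (Fin m) ℝ).toBasis
    ((coorientAlternating ν).compLinearMap L)
  have h2 := congrArg (fun φ => φ b) h
  simp only [AlternatingMap.smul_apply, AlternatingMap.compLinearMap_apply,
    coorientAlternating_apply] at h2
  have h3 : (EuclideanSpace.basisFun (Fin m) ℝ).toBasis.det b = vecDet b := by
    rw [Module.Basis.det_apply, vecDet, ← Matrix.det_transpose]
    rfl
  rw [h3] at h2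
  simpa [Function.comp_def, mul_comm] using h2

theorem hasFDerivAt_coorientForm {E : Type*} [NormedAddCommGroup E] [NormedSpace ℝ E]
    {v : Fin m → E → Euc (m + 1)} {N : E → Euc (m + 1)} {u : E}
    (hv : ∀ j, DifferentiableAt ℝ (v j) u) (hN : DifferentiableAt ℝ N u) :
    DifferentiableAt ℝ (fun w => coorientForm (N w) fun j => v j w) u ∧
    ∀ X, fderiv ℝ (fun w => coorientForm (N w) fun j => v j w) u X =
      ∑ j, coorientForm (N u) (Function.update (fun j => v j u) j (fderiv ℝ (v j) u X)) +
        coorientForm (fderiv ℝ N u X) fun j => v j u := by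
  have key : HasFDerivAt (fun w => vecDetMultilinear (m + 1)
      (Fin.snoc (α := fun _ => Euc (m + 1)) (fun j => v j w) (N w))) _ u :=
    HasFDerivAt.multilinear_comp (vecDetMultilinear (m + 1))
      (g := fun i w => Fin.snoc (α := fun _ => Euc (m + 1)) (fun j => v j w) (N w) i)
      (g' := fun i => Fin.snoc (α := fun _ => E →L[ℝ] Euc (m + 1)) (fun j => fderiv ℝ (v j) u)
        (fderiv ℝ N u) i) (by
        intro i
        refine Fin.lastCases ?_ (fun j => ?_) i
        · simpa using hN.hasFDerivAt
        · simpa using (hv j).hasFDerivAt)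
  refine ⟨key.differentiableAt, fun X => ?_⟩
  have := key.fderiv
  change fderiv ℝ (fun w => coorientForm (N w) fun j => v j w) u = _ at this
  rw [this]
  simp only [FunLike.coe_sum, Finset.sum_apply, ContinuousLinearMap.comp_apply]
  rw [Fin.sum_univ_castSucc]
  simp [ContinuousMultilinearMap.toContinuousLinearMap, vecDetMultilinear_apply, coorientForm,
    Fin.snoc_update, Fin.update_snoc_last]

end Determinants

/-! ### Unit normals, the second fundamental form and the signed Jacobian in coordinates. -/

section UnitNormals

theorem two_le_infty : (2 : WithTop ℕ∞) ≤ ∞ :=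
  WithTop.coe_le_coe.2 (le_top : (2 : ℕ∞) ≤ ⊤)

variable {m : ℕ}

/-- `N` is a smooth unit normal vector field along the smooth map `F` on the open set `Ω`. -/
structure IsNormalAlong (F N : Euc m → Euc (m + 1)) (Ω : Set (Euc m)) : Prop where
  isOpen : IsOpen Ω
  smooth_map : ContDiffOn ℝ ∞ F Ω
  smooth : ContDiffOn ℝ ∞ N Ω
  norm_eq : ∀ u ∈ Ω, ‖N u‖ = 1
  normal : ∀ u ∈ Ω, ∀ X, inner ℝ (fderiv ℝ F u X) (N u) = 0

/-- The second fundamental form `-⟨dF(X), dN(Y)⟩` in coordinates. -/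
noncomputable def sff (F N : Euc m → Euc (m + 1)) (u X Y : Euc m) : ℝ :=
  -inner ℝ (fderiv ℝ F u X) (fderiv ℝ N u Y)

namespace IsNormalAlong

variable {F N : Euc m → Euc (m + 1)} {Ω : Set (Euc m)} {u : Euc m}

theorem mono (h : IsNormalAlong F N Ω) {Ω' : Set (Euc m)} (ho : IsOpen Ω') (hs : Ω' ⊆ Ω) :
    IsNormalAlong F N Ω' :=
  ⟨ho, h.smooth_map.mono hs, h.smooth.mono hs, fun u hu => h.norm_eq u (hs hu),
    fun u hu => h.normal u (hs hu)⟩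

theorem mem_nhds (h : IsNormalAlong F N Ω) (hu : u ∈ Ω) : Ω ∈ 𝓝 u := h.isOpen.mem_nhds hu

theorem contDiffAt_map (h : IsNormalAlong F N Ω) (hu : u ∈ Ω) : ContDiffAt ℝ ∞ F u :=
  h.smooth_map.contDiffAt (h.mem_nhds hu)

theorem contDiffAt (h : IsNormalAlong F N Ω) (hu : u ∈ Ω) : ContDiffAt ℝ ∞ N u :=
  h.smooth.contDiffAt (h.mem_nhds hu)

theorem contDiffAt_fderiv_map (h : IsNormalAlong F N Ω) (hu : u ∈ Ω) :
    ContDiffAt ℝ ∞ (fderiv ℝ F) u :=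
  (h.contDiffAt_map hu).fderiv_right (by simp)

theorem contDiffAt_fderiv (h : IsNormalAlong F N Ω) (hu : u ∈ Ω) :
    ContDiffAt ℝ ∞ (fderiv ℝ N) u :=
  (h.contDiffAt hu).fderiv_right (by simp)

theorem contDiffAt_fderiv_fderiv_map (h : IsNormalAlong F N Ω) (hu : u ∈ Ω) :
    ContDiffAt ℝ ∞ (fderiv ℝ (fderiv ℝ F)) u :=
  (h.contDiffAt_fderiv_map hu).fderiv_right (by simp)

theorem differentiableAt (h : IsNormalAlong F N Ω) (hu : u ∈ Ω) : DifferentiableAt ℝ N u :=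
  (h.contDiffAt hu).differentiableAt (by simp)

theorem differentiableAt_fderiv_map (h : IsNormalAlong F N Ω) (hu : u ∈ Ω) :
    DifferentiableAt ℝ (fderiv ℝ F) u :=
  (h.contDiffAt_fderiv_map hu).differentiableAt (by simp)

theorem differentiableAt_fderiv_map_apply (h : IsNormalAlong F N Ω) (hu : u ∈ Ω) (X : Euc m) :
    DifferentiableAt ℝ (fun v => fderiv ℝ F v X) u :=
  (h.differentiableAt_fderiv_map hu).clm_apply (differentiableAt_const X)

theorem differentiableAt_fderiv_apply (h : IsNormalAlong F N Ω) (hu : u ∈ Ω) (X : Euc m) :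
    DifferentiableAt ℝ (fun v => fderiv ℝ N v X) u :=
  ((h.contDiffAt_fderiv hu).differentiableAt (by simp)).clm_apply (differentiableAt_const X)

theorem fderiv_fderiv_map_apply (h : IsNormalAlong F N Ω) (hu : u ∈ Ω) (X Y : Euc m) :
    fderiv ℝ (fun v => fderiv ℝ F v X) u Y = fderiv ℝ (fderiv ℝ F) u Y X := by
  rw [fderiv_clm_apply (h.differentiableAt_fderiv_map hu) (differentiableAt_const X)]
  simp

theorem fderiv_fderiv_symm (h : IsNormalAlong F N Ω) (hu : u ∈ Ω) (X Y : Euc m) :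
    fderiv ℝ (fderiv ℝ F) u X Y = fderiv ℝ (fderiv ℝ F) u Y X :=
  ((h.contDiffAt_map hu).isSymmSndFDerivAt (by simpa using two_le_infty)).eq X Y

theorem inner_fderiv_self (h : IsNormalAlong F N Ω) (hu : u ∈ Ω) (X : Euc m) :
    inner ℝ (fderiv ℝ N u X) (N u) = 0 := by
  have hc : (fun v => inner ℝ (N v) (N v)) =ᶠ[𝓝 u] fun _ => (1 : ℝ) := by
    filter_upwards [h.mem_nhds hu] with v hv
    rw [real_inner_self_eq_norm_sq, h.norm_eq v hv, one_pow]
  have h1 := hc.fderiv_eq (𝕜 := ℝ)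
  have h2 := fderiv_inner_apply ℝ (h.differentiableAt hu) (h.differentiableAt hu) X
  rw [h1] at h2
  rw [real_inner_comm (fderiv ℝ N u X) (N u)] at h2
  simp only [fderiv_fun_const, Pi.zero_apply, zero_apply] at h2
  linarith

/-- The second fundamental form is the normal component of the second derivative. -/
theorem sff_eq (h : IsNormalAlong F N Ω) (hu : u ∈ Ω) (X Y : Euc m) :
    sff F N u X Y = inner ℝ (fderiv ℝ (fderiv ℝ F) u Y X) (N u) := by
  -- The relation ⟨dF(X), N⟩ = 0 holds on an open set and is differentiated in the direction Y.
  have hc : (fun v => inner ℝ (fderiv ℝ F v X) (N v)) =ᶠ[𝓝 u] fun _ => (0 : ℝ) := by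
    filter_upwards [h.mem_nhds hu] with v hv using h.normal v hv X
  have h1 := hc.fderiv_eq (𝕜 := ℝ)
  have h2 := fderiv_inner_apply ℝ (h.differentiableAt_fderiv_map_apply hu X)
    (h.differentiableAt hu) Y
  rw [h1, h.fderiv_fderiv_map_apply hu] at h2
  simp only [fderiv_fun_const, Pi.zero_apply, zero_apply] at h2
  rw [sff]
  linarith

theorem sff_symm (h : IsNormalAlong F N Ω) (hu : u ∈ Ω) (X Y : Euc m) :
    sff F N u X Y = sff F N u Y X := by
  rw [h.sff_eq hu, h.sff_eq hu, h.fderiv_fderiv_symm hu]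

theorem jacobian_mul (F N : Euc m → Euc (m + 1)) (u : Euc m) (b : Fin m → Euc m) :
    vecDet b * jacobian F N u = coorientForm (N u) fun j => fderiv ℝ F u (b j) :=
  (coorientForm_map (N u) (fderiv ℝ F u : Euc m →ₗ[ℝ] Euc (m + 1)) b).symm

theorem jacobian_ne_zero_iff (h : IsNormalAlong F N Ω) (hu : u ∈ Ω) :
    jacobian F N u ≠ 0 ↔ Function.Injective (fderiv ℝ F u) := by
  let b := (EuclideanSpace.basisFun (Fin m) ℝ).toBasis
  have hb : (fun j => pd j F u) = (fderiv ℝ F u : Euc m →ₗ[ℝ] Euc (m + 1)) ∘ b := by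
    ext1 j
    simp [b, pd]
  rw [jacobian, coorientForm_ne_zero_iff (h.norm_eq u hu) (v := fun j => pd j F u)
    fun i => h.normal u hu _, hb]
  constructor
  · intro hl
    exact LinearMap.injective_of_linearIndependent b.span_eq hl
  · intro hi
    exact b.linearIndependent.map' _ (LinearMap.ker_eq_bot.2 hi)

theorem differentiableAt_jacobian (h : IsNormalAlong F N Ω) (hu : u ∈ Ω) :
    DifferentiableAt ℝ (jacobian F N) u :=
  (hasFDerivAt_coorientForm (fun _ => h.differentiableAt_fderiv_map_apply hu _)
    (h.differentiableAt hu)).1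

end IsNormalAlong

end UnitNormals

/-! ### The Gauss equation for the induced metric. -/

section GaussEquation

variable {m : ℕ}

theorem differentiableAt_det {E : Type*} [NormedAddCommGroup E] [NormedSpace ℝ E] {n : ℕ}
    {A : E → Matrix (Fin n) (Fin n) ℝ} {u : E}
    (hA : ∀ i j, DifferentiableAt ℝ (fun v => A v i j) u) :
    DifferentiableAt ℝ (fun v => (A v).det) u := by
  simp only [Matrix.det_apply']
  fun_prop

theorem differentiableAt_inv_apply {E : Type*} [NormedAddCommGroup E] [NormedSpace ℝ E] {n : ℕ}
    {A : E → Matrix (Fin n) (Fin n) ℝ} {u : E}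
    (hA : ∀ i j, DifferentiableAt ℝ (fun v => A v i j) u) (hu : (A u).det ≠ 0) (k l : Fin n) :
    DifferentiableAt ℝ (fun v => (A v)⁻¹ k l) u := by
  -- The adjugate formula presents the entries of the inverse as determinants divided by det A.
  have h1 : ∀ v, (A v)⁻¹ k l = ((A v).det)⁻¹ * ((A v).updateRow l (Pi.single k 1)).det := by
    intro v
    rw [Matrix.inv_def, Ring.inverse_eq_inv', Matrix.smul_apply, Matrix.adjugate_apply, smul_eq_mul]
  simp only [h1]
  refine ((differentiableAt_det hA).inv hu).mul (differentiableAt_det fun i j => ?_)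
  by_cases hi : i = l
  · subst hi; simp
  · simpa [Matrix.updateRow_ne hi] using hA i j

theorem metricApply_firstFormMatrix (F : Euc m → Euc (m + 1)) (u X Y : Euc m) :
    metricApply (firstFormMatrix F) u X Y = inner ℝ (fderiv ℝ F u X) (fderiv ℝ F u Y) := by
  have hX : ∀ X : Euc m, fderiv ℝ F u X = ∑ i, X i • pd i F u := by
    intro X
    conv_lhs => rw [← (EuclideanSpace.basisFun (Fin m) ℝ).sum_repr X]
    simp [pd]
  rw [hX X, hX Y, sum_inner, metricApply]
  refine Finset.sum_congr rfl fun i _ => ?_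
  rw [inner_sum]
  refine Finset.sum_congr rfl fun j _ => ?_
  rw [inner_smul_left, inner_smul_right]
  simp [firstFormMatrix]
  ring

theorem det_firstFormMatrix_ne_zero {F : Euc m → Euc (m + 1)} {u : Euc m}
    (hi : Function.Injective (fderiv ℝ F u)) : (firstFormMatrix F u).det ≠ 0 := by
  intro h0
  obtain ⟨x, hx, hx0⟩ := Matrix.exists_mulVec_eq_zero_iff.2 h0
  apply hx
  have h1 : metricApply (firstFormMatrix F) u (WithLp.toLp 2 x) (WithLp.toLp 2 x) = 0 := by
    have : ∀ i, ∑ j, firstFormMatrix F u i j * x i * x j = 0 := by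
      intro i
      have := congrFun hx0 i
      simp only [Matrix.mulVec, dotProduct, Pi.zero_apply] at this
      calc _ = x i * ∑ j, firstFormMatrix F u i j * x j := by
            rw [Finset.mul_sum]; exact Finset.sum_congr rfl fun j _ => by ring
        _ = 0 := by rw [this, mul_zero]
    simp [metricApply, this]
  rw [metricApply_firstFormMatrix, inner_self_eq_zero] at h1
  have h2 : (WithLp.toLp 2 x : Euc m) = 0 := hi (by rw [h1, map_zero])
  simpa using h2

namespace IsNormalAlong

variable {F N : Euc m → Euc (m + 1)} {Ω : Set (Euc m)} {u : Euc m}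

theorem injective_eventually (h : IsNormalAlong F N Ω) (hu : u ∈ Ω)
    (hi : Function.Injective (fderiv ℝ F u)) :
    ∀ᶠ v in 𝓝 u, v ∈ Ω ∧ Function.Injective (fderiv ℝ F v) := by
  have h1 := (h.jacobian_ne_zero_iff hu).2 hi
  filter_upwards [h.mem_nhds hu, (h.differentiableAt_jacobian hu).continuousAt.eventually_ne h1]
    with v hv hv' using ⟨hv, (h.jacobian_ne_zero_iff hv).1 hv'⟩

/-- The orthogonal complement of the image of an injective differential is spanned by the
unit normal vector. -/
theorem eq_smul_normal (h : IsNormalAlong F N Ω) (hu : u ∈ Ω)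
    (hi : Function.Injective (fderiv ℝ F u)) {z : Euc (m + 1)}
    (hz : ∀ X, inner ℝ z (fderiv ℝ F u X) = 0) : z = inner ℝ z (N u) • N u := by
  set y := z - inner ℝ z (N u) • N u with hy
  have hyN : inner ℝ y (N u) = 0 := by
    rw [hy, inner_sub_left, inner_smul_left, real_inner_self_eq_norm_sq, h.norm_eq u hu]
    simp
  have hyX : ∀ X, inner ℝ y (fderiv ℝ F u X) = 0 := by
    intro X
    rw [hy, inner_sub_left, inner_smul_left, hz, real_inner_comm (fderiv ℝ F u X) (N u), h.normal u hu]
    simp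
  have hdet := (h.jacobian_ne_zero_iff hu).2 hi
  exact sub_eq_zero.1 (eq_zero_of_inner_eq_zero hdet (fun _ => hyX _) hyN)

variable (F) in
/-- The second partial derivatives of `F`. -/
noncomputable def _root_.WaveFront.pd₂ (i j : Fin m) (u : Euc m) : Euc (m + 1) :=
  fderiv ℝ (fderiv ℝ F) u (EuclideanSpace.single i 1) (EuclideanSpace.single j 1)

theorem pd₂_symm (h : IsNormalAlong F N Ω) (hu : u ∈ Ω) (i j : Fin m) :
    pd₂ F i j u = pd₂ F j i u :=
  h.fderiv_fderiv_symm hu _ _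

theorem differentiableAt_pd (h : IsNormalAlong F N Ω) (hu : u ∈ Ω) (i : Fin m) :
    DifferentiableAt ℝ (fun v => pd i F v) u :=
  h.differentiableAt_fderiv_map_apply hu _

theorem differentiableAt_pd₂ (h : IsNormalAlong F N Ω) (hu : u ∈ Ω) (i j : Fin m) :
    DifferentiableAt ℝ (fun v => pd₂ F i j v) u :=
  (((h.contDiffAt_fderiv_fderiv_map hu).differentiableAt (by simp)).clm_apply
    (differentiableAt_const _)).clm_apply (differentiableAt_const _)

theorem pd_pd (h : IsNormalAlong F N Ω) (hu : u ∈ Ω) (i j : Fin m) :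
    pd i (fun v => pd j F v) u = pd₂ F i j u :=
  h.fderiv_fderiv_map_apply hu _ _

theorem pd_pd₂_symm (h : IsNormalAlong F N Ω) (hu : u ∈ Ω) (i j k : Fin m) :
    pd i (fun v => pd₂ F j k v) u = pd j (fun v => pd₂ F i k v) u := by
  have hd := (h.contDiffAt_fderiv_fderiv_map hu).differentiableAt (by simp)
  have hsymm : IsSymmSndFDerivAt ℝ (fderiv ℝ F) u :=
    (h.contDiffAt_fderiv_map hu).isSymmSndFDerivAt (by simpa using two_le_infty)
  have key : ∀ i j : Fin m, pd i (fun v => pd₂ F j k v) u =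
      fderiv ℝ (fderiv ℝ (fderiv ℝ F)) u (EuclideanSpace.single i 1) (EuclideanSpace.single j 1)
        (EuclideanSpace.single k 1) := by
    intro i j
    simp only [pd, pd₂]
    rw [fderiv_clm_apply (hd.clm_apply (differentiableAt_const _)) (differentiableAt_const _),
      fderiv_clm_apply hd (differentiableAt_const _)]
    simp
  rw [key, key, hsymm.eq]

theorem pd_firstFormMatrix (h : IsNormalAlong F N Ω) (hu : u ∈ Ω) (i j l : Fin m) :
    pd i (fun v => firstFormMatrix F v j l) u =
      inner ℝ (pd₂ F i j u) (pd l F u) + inner ℝ (pd j F u) (pd₂ F i l u) := by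
  have := fderiv_inner_apply ℝ (h.differentiableAt_pd hu j) (h.differentiableAt_pd hu l)
    (EuclideanSpace.single i 1)
  rw [← h.pd_pd hu, ← h.pd_pd hu, add_comm]
  exact this

/-- Each metric derivative is a sum of two inner products; by symmetry of second derivatives four of
the six cancel and the other two coincide. -/
theorem christoffel_eq (h : IsNormalAlong F N Ω) (hu : u ∈ Ω) (k i j : Fin m) :
    christoffel (firstFormMatrix F) k i j u =
      ∑ l, (firstFormMatrix F u)⁻¹ k l * inner ℝ (pd₂ F i j u) (pd l F u) := by
  rw [christoffel, Finset.mul_sum]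
  refine Finset.sum_congr rfl fun l _ => ?_
  rw [h.pd_firstFormMatrix hu, h.pd_firstFormMatrix hu, h.pd_firstFormMatrix hu,
    h.pd₂_symm hu j i, h.pd₂_symm hu l i, h.pd₂_symm hu l j,
    real_inner_comm (pd₂ F i l u), real_inner_comm (pd₂ F j l u)]
  ring

theorem sum_christoffel_mul (h : IsNormalAlong F N Ω) (hu : u ∈ Ω)
    (hi : Function.Injective (fderiv ℝ F u)) (i j s : Fin m) :
    ∑ k, christoffel (firstFormMatrix F) k i j u * firstFormMatrix F u k s =
      inner ℝ (pd₂ F i j u) (pd s F u) := by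
  have hinv : firstFormMatrix F u * (firstFormMatrix F u)⁻¹ = 1 :=
    Matrix.mul_nonsing_inv _ (det_firstFormMatrix_ne_zero hi).isUnit
  have hsymm : ∀ k, firstFormMatrix F u k s = firstFormMatrix F u s k := fun k => by
    simp [firstFormMatrix, real_inner_comm]
  simp only [h.christoffel_eq hu, hsymm, Finset.sum_mul]
  rw [Finset.sum_comm]
  have : ∀ l, ∑ k, (firstFormMatrix F u)⁻¹ k l * inner ℝ (pd₂ F i j u) (pd l F u) *
      firstFormMatrix F u s k =
      (1 : Matrix (Fin m) (Fin m) ℝ) s l * inner ℝ (pd₂ F i j u) (pd l F u) := by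
    intro l
    rw [← hinv, Matrix.mul_apply, Finset.sum_mul]
    exact Finset.sum_congr rfl fun k _ => by ring
  simp [this, Matrix.one_apply]

theorem differentiableAt_christoffel (h : IsNormalAlong F N Ω) (hu : u ∈ Ω)
    (hi : Function.Injective (fderiv ℝ F u)) (k i j : Fin m) :
    DifferentiableAt ℝ (christoffel (firstFormMatrix F) k i j) u := by
  have hev : christoffel (firstFormMatrix F) k i j =ᶠ[𝓝 u] fun v =>
      ∑ l, (firstFormMatrix F v)⁻¹ k l * inner ℝ (pd₂ F i j v) (pd l F v) := by
    filter_upwards [h.mem_nhds hu] with v hv using h.christoffel_eq hv k i j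
  refine DifferentiableAt.congr_of_eventuallyEq ?_ hev
  refine DifferentiableAt.fun_sum fun l _ => DifferentiableAt.mul ?_ ?_
  · refine differentiableAt_inv_apply (fun a b => ?_) (det_firstFormMatrix_ne_zero hi) k l
    exact (h.differentiableAt_pd hu a).inner ℝ (h.differentiableAt_pd hu b)
  · exact (h.differentiableAt_pd₂ hu i j).inner ℝ (h.differentiableAt_pd hu l)

/-- The Gauss formula: the decomposition of the second derivative into its tangential and
normal components. -/
theorem pd₂_eq (h : IsNormalAlong F N Ω) (hu : u ∈ Ω)
    (hi : Function.Injective (fderiv ℝ F u)) (j k : Fin m) :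
    pd₂ F j k u = ∑ l, christoffel (firstFormMatrix F) l j k u • pd l F u +
      inner ℝ (pd₂ F j k u) (N u) • N u := by
  set T := ∑ l, christoffel (firstFormMatrix F) l j k u • pd l F u with hT
  have hTN : inner ℝ T (N u) = 0 := by
    rw [hT, sum_inner]
    exact Finset.sum_eq_zero fun l _ => by rw [inner_smul_left, pd, h.normal u hu, mul_zero]
  have hTs : ∀ s, inner ℝ (pd₂ F j k u - T) (pd s F u) = 0 := by
    intro s
    rw [inner_sub_left, ← h.sum_christoffel_mul hu hi, hT, sum_inner, sub_eq_zero]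
    exact Finset.sum_congr rfl fun l _ => by simp [inner_smul_left, firstFormMatrix]
  have h1 := h.eq_smul_normal hu hi (z := pd₂ F j k u - T) (fun X => by
    have hX : fderiv ℝ F u X = ∑ i, X i • pd i F u := by
      conv_lhs => rw [← (EuclideanSpace.basisFun (Fin m) ℝ).sum_repr X]
      simp [pd]
    rw [hX, inner_sum]
    exact Finset.sum_eq_zero fun i _ => by rw [inner_smul_right, hTs, mul_zero])
  rw [inner_sub_left, hTN, sub_zero] at h1
  rw [← h1]
  abel

/-- The Gauss equation in coordinates. -/
theorem sum_firstFormMatrix_mul_riemann (h : IsNormalAlong F N Ω) (hu : u ∈ Ω)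
    (hi : Function.Injective (fderiv ℝ F u)) (s k i j : Fin m) :
    ∑ l, firstFormMatrix F u l s * riemann (firstFormMatrix F) l k i j u =
      inner ℝ (pd₂ F j k u) (N u) * inner ℝ (pd₂ F i s u) (N u) -
        inner ℝ (pd₂ F i k u) (N u) * inner ℝ (pd₂ F j s u) (N u) := by
  set Γ := christoffel (firstFormMatrix F) with hΓ
  -- the derivative of `∑ Γˡⱼₖ gₗₛ = ⟨Fⱼₖ, Fₛ⟩`
  have hder : ∀ i j, ∑ l, firstFormMatrix F u l s * pd i (Γ l j k) u =
      inner ℝ (pd i (fun v => pd₂ F j k v) u) (pd s F u) + inner ℝ (pd₂ F j k u) (pd₂ F i s u) -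
      ∑ l, Γ l j k u * (inner ℝ (pd₂ F i l u) (pd s F u) + inner ℝ (pd l F u) (pd₂ F i s u)) := by
    intro i j
    have hev : (fun v => ∑ l, Γ l j k v * firstFormMatrix F v l s) =ᶠ[𝓝 u]
        fun v => inner ℝ (pd₂ F j k v) (pd s F v) := by
      filter_upwards [h.injective_eventually hu hi] with v hv
        using h.sum_christoffel_mul hv.1 hv.2 j k s
    have h1 := DFunLike.congr_fun (hev.fderiv_eq (𝕜 := ℝ)) (EuclideanSpace.single i (1 : ℝ))
    have hg : ∀ l, DifferentiableAt ℝ (fun v => firstFormMatrix F v l s) u := fun l =>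
      (h.differentiableAt_pd hu l).inner ℝ (h.differentiableAt_pd hu s)
    have hΓd : ∀ l, DifferentiableAt ℝ (Γ l j k) u :=
      fun l => h.differentiableAt_christoffel hu hi l j k
    have hΓg : ∀ l, DifferentiableAt ℝ (fun v => Γ l j k v * firstFormMatrix F v l s) u :=
      fun l => (hΓd l).mul (hg l)
    rw [fderiv_inner_apply ℝ (h.differentiableAt_pd₂ hu j k) (h.differentiableAt_pd hu s),
      fderiv_fun_sum fun l _ => hΓg l] at h1
    have h2 : ∀ l, fderiv ℝ (fun v => Γ l j k v * firstFormMatrix F v l s) u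
        (EuclideanSpace.single i 1) = firstFormMatrix F u l s * pd i (Γ l j k) u +
        Γ l j k u * (inner ℝ (pd₂ F i l u) (pd s F u) + inner ℝ (pd l F u) (pd₂ F i s u)) := by
      intro l
      rw [fderiv_fun_mul (hΓd l) (hg l), ← h.pd_firstFormMatrix hu]
      simp [pd]
      ring
    simp only [FunLike.coe_sum, Finset.sum_apply, h2, Finset.sum_add_distrib] at h1
    have h3 := h.pd_pd hu i s
    simp only [pd] at h3 h1 ⊢
    rw [h3] at h1
    simp only [Finset.sum_add_distrib, mul_add] at h1 ⊢
    linarith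
  have hquad : ∀ i j, ∑ l, firstFormMatrix F u l s * ∑ t, Γ t j k u * Γ l i t u =
      ∑ t, Γ t j k u * inner ℝ (pd₂ F i t u) (pd s F u) := by
    intro i j
    simp only [Finset.mul_sum]
    rw [Finset.sum_comm]
    refine Finset.sum_congr rfl fun t _ => ?_
    rw [← h.sum_christoffel_mul hu hi, Finset.mul_sum]
    exact Finset.sum_congr rfl fun l _ => by ring
  -- By the Gauss formula, subtracting the tangential part of Fⱼₖ leaves only the product of normal
  -- components.
  have hnorm : ∀ i j, inner ℝ (pd₂ F j k u) (pd₂ F i s u) -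
      ∑ l, Γ l j k u * inner ℝ (pd l F u) (pd₂ F i s u) =
      inner ℝ (pd₂ F j k u) (N u) * inner ℝ (pd₂ F i s u) (N u) := by
    intro i j
    have h1 := congrArg (fun z => inner ℝ z (pd₂ F i s u)) (h.pd₂_eq hu hi j k)
    simp only [inner_add_left, sum_inner, inner_smul_left, RCLike.conj_to_real] at h1
    rw [real_inner_comm (pd₂ F i s u) (N u)] at h1
    linarith
  have h1 := hder i j
  have h2 := hder j i
  -- The third derivatives of F are symmetric in i and j, so they cancel in the difference of `h1`
  -- and `h2`.
  rw [h.pd_pd₂_symm hu j i k] at h2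
  simp only [mul_add, Finset.sum_add_distrib] at h1 h2
  have hsplit : ∑ l, firstFormMatrix F u l s * riemann (firstFormMatrix F) l k i j u =
      ∑ l, firstFormMatrix F u l s * pd i (Γ l j k) u -
      ∑ l, firstFormMatrix F u l s * pd j (Γ l i k) u +
      (∑ l, firstFormMatrix F u l s * ∑ t, Γ t j k u * Γ l i t u -
       ∑ l, firstFormMatrix F u l s * ∑ t, Γ t i k u * Γ l j t u) := by
    rw [← Finset.sum_sub_distrib, ← Finset.sum_sub_distrib, ← Finset.sum_add_distrib]
    refine Finset.sum_congr rfl fun l _ => ?_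
    rw [riemann, Finset.sum_sub_distrib]
    ring
  rw [hsplit, hquad, hquad]
  linarith [hnorm i j, hnorm j i]

theorem sff_eq_sum (h : IsNormalAlong F N Ω) (hu : u ∈ Ω) (X Y : Euc m) :
    sff F N u X Y = ∑ i, ∑ j, inner ℝ (pd₂ F i j u) (N u) * X i * Y j := by
  have hX : ∀ X : Euc m, X = ∑ i, X i • EuclideanSpace.single i (1 : ℝ) := by
    intro X
    conv_lhs => rw [← (EuclideanSpace.basisFun (Fin m) ℝ).sum_repr X]
    simp
  rw [h.sff_eq hu, h.fderiv_fderiv_symm hu]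
  conv_lhs => rw [hX X, hX Y]
  simp only [map_sum, map_smul, FunLike.coe_sum, Finset.sum_apply, FunLike.coe_smul,
    Pi.smul_apply, sum_inner, inner_smul_left, RCLike.conj_to_real, pd₂, Finset.smul_sum]
  rw [Finset.sum_comm]
  exact Finset.sum_congr rfl fun i _ => Finset.sum_congr rfl fun j _ => by ring

/-- The Gauss equation for the sectional curvature. -/
theorem sectional_eq (h : IsNormalAlong F N Ω) (hu : u ∈ Ω)
    (hi : Function.Injective (fderiv ℝ F u)) (X Y : Euc m) :
    sectional (firstFormMatrix F) u X Y =
      (sff F N u X X * sff F N u Y Y - sff F N u X Y ^ 2) /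
        (inner ℝ (fderiv ℝ F u X) (fderiv ℝ F u X) * inner ℝ (fderiv ℝ F u Y) (fderiv ℝ F u Y) -
          inner ℝ (fderiv ℝ F u X) (fderiv ℝ F u Y) ^ 2) := by
  rw [sectional, metricApply_firstFormMatrix, metricApply_firstFormMatrix,
    metricApply_firstFormMatrix]
  congr 1
  have h1 : ∀ i j k, ∑ l, ∑ s, firstFormMatrix F u l s * riemann (firstFormMatrix F) l k i j u *
      X i * Y j * Y k * X s =
      ∑ s, (inner ℝ (pd₂ F j k u) (N u) * inner ℝ (pd₂ F i s u) (N u) -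
        inner ℝ (pd₂ F i k u) (N u) * inner ℝ (pd₂ F j s u) (N u)) * X i * Y j * Y k * X s := by
    intro i j k
    rw [Finset.sum_comm]
    refine Finset.sum_congr rfl fun s _ => ?_
    rw [← h.sum_firstFormMatrix_mul_riemann hu hi]
    simp only [Finset.sum_mul]
  simp only [h1]
  rw [sq]
  -- One factor of II(X, Y)² is transposed so that the two quadruple sums agree index by index.
  nth_rewrite 2 [h.sff_symm hu X Y]
  simp only [h.sff_eq_sum hu]
  have h2 : ∀ i j k s : Fin m, (inner ℝ (pd₂ F j k u) (N u) * inner ℝ (pd₂ F i s u) (N u) -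
      inner ℝ (pd₂ F i k u) (N u) * inner ℝ (pd₂ F j s u) (N u)) * X i * Y j * Y k * X s =
      (inner ℝ (pd₂ F i s u) (N u) * X i * X s) * (inner ℝ (pd₂ F j k u) (N u) * Y j * Y k) -
      (inner ℝ (pd₂ F i k u) (N u) * X i * Y k) * (inner ℝ (pd₂ F j s u) (N u) * Y j * X s) := by
    intros
    ring
  simp only [h2, Finset.sum_sub_distrib, ← Finset.sum_mul, ← Finset.mul_sum]

end IsNormalAlong

end GaussEquation

/-! ### Null vectors, the derivative of the signed Jacobian, and independence of the chosen normal.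
-/

section NullDirections

variable {m : ℕ}

theorem coorientForm_smul_normal (c : ℝ) (ν : Euc (m + 1)) (v : Fin m → Euc (m + 1)) :
    coorientForm (c • ν) v = c * coorientForm ν v := by
  have h := (vecDetMultilinear (m + 1)).map_update_smul
    (Fin.snoc (α := fun _ => Euc (m + 1)) v ν) (Fin.last m) c ν
  simpa [Fin.update_snoc_last, vecDetMultilinear_apply, coorientForm] using h

theorem coorientForm_eq_zero_of_row_eq_zero (ν : Euc (m + 1)) {v : Fin m → Euc (m + 1)} {i : Fin m}
    (hi : v i = 0) : coorientForm ν v = 0 :=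
  (coorientAlternating ν).map_coord_zero i hi

theorem eq_zero_of_apply_eq_zero {E : Type*} [AddCommGroup E] [Module ℝ E] {b : Fin m → Euc m}
    (hb : vecDet b ≠ 0) {L : Euc m →ₗ[ℝ] E} (hL : ∀ j, L (b j) = 0) : L = 0 := by
  have hb' := (vecDet_ne_zero_iff b).1 hb
  have hspan := hb'.span_eq_top_of_card_eq_finrank' (by simp)
  exact LinearMap.ext_on_range hspan (by simpa using hL)

theorem exists_basis_apply_eq {η : Euc m} (hη : η ≠ 0) :
    ∃ (b : Fin m → Euc m) (j : Fin m), vecDet b ≠ 0 ∧ b j = η := by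
  have hli : LinearIndepOn ℝ id ({η} : Set (Euc m)) := LinearIndepOn.singleton hη
  let B := Module.Basis.extend hli
  have : Fintype (hli.extend (Set.subset_univ _)) := FiniteDimensional.fintypeBasisIndex B
  have hcard : Fintype.card (hli.extend (Set.subset_univ _)) = m := by
    rw [← Module.finrank_eq_card_basis B]; simp
  let e := Fintype.equivFinOfCardEq hcard
  refine ⟨B.reindex e, e ⟨η, hli.subset_extend _ rfl⟩,
    (vecDet_ne_zero_iff _).2 (B.reindex e).linearIndependent, ?_⟩
  simp [B]

namespace IsNormalAlong

variable {F N : Euc m → Euc (m + 1)} {Ω : Set (Euc m)} {u : Euc m}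

theorem contDiffAt_jacobian (h : IsNormalAlong F N Ω) (hu : u ∈ Ω) :
    ContDiffAt ℝ ∞ (jacobian F N) u := by
  refine (vecDetMultilinear (m + 1)).contDiff.contDiffAt.comp u (contDiffAt_pi.2 fun i => ?_)
  refine Fin.lastCases ?_ (fun j => ?_) i
  · simpa using h.contDiffAt hu
  · simpa [pd] using (h.contDiffAt_fderiv_map hu).clm_apply
      (contDiffAt_const (c := EuclideanSpace.single j (1 : ℝ)))

/-- The derivative of the signed Jacobian at a singular point, in terms of a frame that contains
a null vector. -/
theorem vecDet_mul_fderiv_jacobian (h : IsNormalAlong F N Ω) (hu : u ∈ Ω) {b : Fin m → Euc m}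
    {j : Fin m} (hj : fderiv ℝ F u (b j) = 0) (v : Euc m) :
    vecDet b * fderiv ℝ (jacobian F N) u v = coorientForm (N u)
      (Function.update (fun i => fderiv ℝ F u (b i)) j (fderiv ℝ (fderiv ℝ F) u v (b j))) := by
  have h1 : (fun w => vecDet b * jacobian F N w) =
      fun w => coorientForm (N w) fun i => fderiv ℝ F w (b i) :=
    funext fun w => jacobian_mul F N w b
  have h2 := (hasFDerivAt_coorientForm (v := fun i w => fderiv ℝ F w (b i))
    (fun i => h.differentiableAt_fderiv_map_apply hu (b i)) (h.differentiableAt hu)).2 v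
  rw [← h1, fderiv_const_mul (h.differentiableAt_jacobian hu)] at h2
  -- In the Leibniz expansion every term that does not differentiate the j-th vector still contains
  -- dF(bⱼ) = 0.
  rw [coorientForm_eq_zero_of_row_eq_zero _ hj, add_zero, Finset.sum_eq_single j] at h2
  · rw [h.fderiv_fderiv_map_apply hu] at h2
    simpa using h2
  · intro i _ hi
    refine coorientForm_eq_zero_of_row_eq_zero _ (i := j) ?_
    rw [Function.update_of_ne hi.symm, hj]
  · simp

theorem jacobian_eq_zero (h : IsNormalAlong F N Ω) (hu : u ∈ Ω) {η : Euc m} (hη : η ≠ 0)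
    (hη0 : fderiv ℝ F u η = 0) : jacobian F N u = 0 := by
  by_contra hne
  exact hη ((h.jacobian_ne_zero_iff hu).1 hne (by rw [hη0, map_zero]))

/-- A null vector transversal to the singular set spans the kernel of the differential. -/
theorem exists_eq_smul_of_null (h : IsNormalAlong F N Ω) (hu : u ∈ Ω) {η : Euc m}
    (hη0 : fderiv ℝ F u η = 0) (hη : fderiv ℝ (jacobian F N) u η ≠ 0) {X : Euc m}
    (hX : fderiv ℝ F u X = 0) : ∃ c : ℝ, X = c • η := by
  have hne : η ≠ 0 := by rintro rfl; simp at hη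
  obtain ⟨b, j, hb, rfl⟩ := exists_basis_apply_eq hne
  have hdet := h.vecDet_mul_fderiv_jacobian hu hη0 (b j)
  -- F_ηη takes the slot of the null vector in a frame. The other dF(bᵢ) are therefore independent,
  -- so a kernel vector has only a bⱼ-component.
  have hli : LinearIndependent ℝ (Function.update (fun i => fderiv ℝ F u (b i)) j
      (fderiv ℝ (fderiv ℝ F) u (b j) (b j))) := by
    have h0 := hdet ▸ mul_ne_zero hb hη
    rw [coorientForm, vecDet_ne_zero_iff, linearIndependent_finSnoc] at h0
    exact h0.1
  have hspan := ((vecDet_ne_zero_iff b).1 hb).span_eq_top_of_card_eq_finrank' (by simp)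
  obtain ⟨c, hc⟩ := (Submodule.mem_span_range_iff_exists_fun ℝ).1 (hspan ▸ Submodule.mem_top (x := X))
  refine ⟨c j, ?_⟩
  have hzero : ∀ i, Function.update c j 0 i = 0 := by
    refine Fintype.linearIndependent_iff.1 hli _ ?_
    rw [← hX, ← hc, map_sum]
    refine Finset.sum_congr rfl fun i _ => ?_
    by_cases hi : i = j
    · subst hi; simp [hη0]
    · simp [hi]
  rw [← hc, Finset.sum_eq_single j]
  · intro i _ hi
    have := hzero i
    rw [Function.update_of_ne hi] at this
    rw [this, zero_smul]
  · simp

/-- Regular points are dense near a point where the differential of the signed Jacobian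
does not vanish. -/
theorem _root_.WaveFront.frequently_jacobian_ne_zero
    (hd : fderiv ℝ (jacobian F N) u ≠ 0) : ∃ᶠ v in 𝓝 u, jacobian F N v ≠ 0 := by
  intro hev
  simp only [not_not] at hev
  have : jacobian F N =ᶠ[𝓝 u] fun _ => (0 : ℝ) := hev
  exact hd (by rw [this.fderiv_eq]; simp)

/-- Two unit normal vector fields agree up to a constant sign near a non-degenerate point. -/
theorem eventuallyEq_smul (h : IsNormalAlong F N Ω) {N' : Euc m → Euc (m + 1)}
    (h' : IsNormalAlong F N' Ω) (hu : u ∈ Ω) (hd : fderiv ℝ (jacobian F N') u ≠ 0) :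
    ∃ ε : ℝ, ε * ε = 1 ∧ N =ᶠ[𝓝 u] fun v => ε • N' v := by
  have hcont : ∀ v ∈ Ω, ContinuousAt (fun v => inner ℝ (N v) (N' v)) v := fun v hv =>
    ((h.contDiffAt hv).continuousAt).inner ((h'.contDiffAt hv).continuousAt)
  -- At a regular point the normal line is unique. The identity then spreads to singular points near
  -- u, since regular points are dense there.
  have hreg : ∀ v ∈ Ω, jacobian F N' v ≠ 0 → inner ℝ (N v) (N' v) * inner ℝ (N v) (N' v) = 1 := by
    intro v hv hne
    have h1 := h'.eq_smul_normal hv ((h'.jacobian_ne_zero_iff hv).1 hne) (z := N v) fun X => by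
      rw [real_inner_comm]; exact h.normal v hv X
    have h2 : inner ℝ (N v) (N v) = (1 : ℝ) := by
      rw [real_inner_self_eq_norm_sq, h.norm_eq v hv, one_pow]
    nth_rewrite 2 [h1] at h2
    rwa [inner_smul_right] at h2
  have hsq : ∀ᶠ v in 𝓝 u, inner ℝ (N v) (N' v) * inner ℝ (N v) (N' v) = 1 := by
    have hd' : ∀ᶠ v in 𝓝 u, fderiv ℝ (jacobian F N') v ≠ 0 :=
      (((h'.contDiffAt_jacobian hu).fderiv_right (m := 0) (by simp)).continuousAt).eventually_ne hd
    filter_upwards [hd', h.mem_nhds hu] with v hv hvΩ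
    by_contra hne
    have h1 : ∀ᶠ w in 𝓝 v, inner ℝ (N w) (N' w) * inner ℝ (N w) (N' w) ≠ 1 :=
      ((hcont v hvΩ).mul (hcont v hvΩ)).eventually_ne hne
    obtain ⟨w, hw, hw1, hw2⟩ := ((frequently_jacobian_ne_zero hv).and_eventually
      (h1.and (h.mem_nhds hvΩ))).exists
    exact hw1 (hreg w hw2 hw)
  refine ⟨inner ℝ (N u) (N' u), hsq.self_of_nhds, ?_⟩
  set ε := inner ℝ (N u) (N' u) with hε
  have hε1 : ε * ε = 1 := hsq.self_of_nhds
  -- The inner product takes only the values ε and -ε, which are 2 apart, so closeness within 1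
  -- fixes the sign.
  have hclose : ∀ᶠ v in 𝓝 u, |inner ℝ (N v) (N' v) - ε| < 1 := by
    have := (hcont u hu).eventually (Metric.ball_mem_nhds _ one_pos)
    simpa [Metric.mem_ball, Real.dist_eq] using this
  filter_upwards [hsq, hclose, h.mem_nhds hu] with v h1 h2 hv
  have h3 : inner ℝ (N v) (N' v) = ε := by
    have h5 : (inner ℝ (N v) (N' v) - ε) * (inner ℝ (N v) (N' v) + ε) = 0 := by linarith
    rcases mul_eq_zero.1 h5 with h6 | h6
    · exact sub_eq_zero.1 h6
    · rw [eq_neg_of_add_eq_zero_left h6, abs_lt] at h2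
      nlinarith
  have h4 : ‖N v - ε • N' v‖ ^ 2 = 0 := by
    rw [norm_sub_sq_real, inner_smul_right, h3, norm_smul, mul_pow, h.norm_eq v hv,
      h'.norm_eq v hv, Real.norm_eq_abs, sq_abs, sq ε, hε1]
    norm_num
  exact sub_eq_zero.1 (norm_eq_zero.1 (pow_eq_zero_iff two_ne_zero |>.1 h4))

end IsNormalAlong

/-- `u` is an `A₂`-point of the front `F` with unit normal vector field `N` on `Ω`. -/
structure IsCuspidal (F N : Euc m → Euc (m + 1)) (Ω : Set (Euc m)) (u : Euc m) : Prop where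
  isNormal : IsNormalAlong F N Ω
  mem : u ∈ Ω
  front : ∀ X, fderiv ℝ F u X = 0 → fderiv ℝ N u X = 0 → X = 0
  null : ∃ η, fderiv ℝ F u η = 0 ∧ fderiv ℝ (jacobian F N) u η ≠ 0

/-- The A₂ condition, the front condition and the form II may each be stated with a different unit
normal. These agree up to a constant sign near the point, and both conditions are insensitive to
that sign. -/
theorem IsNormalAlong.isCuspidal {F N N' N'' : Euc m → Euc (m + 1)} {Ω : Set (Euc m)} {u : Euc m}
    (h : IsNormalAlong F N Ω) (h' : IsNormalAlong F N' Ω) (h'' : IsNormalAlong F N'' Ω)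
    (hu : u ∈ Ω) (hnull : ∃ η, fderiv ℝ F u η = 0 ∧ fderiv ℝ (jacobian F N') u η ≠ 0)
    (hfront : ∀ X, fderiv ℝ F u X = 0 → fderiv ℝ N'' u X = 0 → X = 0) :
    IsCuspidal F N Ω u := by
  obtain ⟨η, hη0, hη⟩ := hnull
  have hd : fderiv ℝ (jacobian F N') u ≠ 0 := fun h0 => hη (by rw [h0]; simp)
  obtain ⟨ε, hε, hN⟩ := h.eventuallyEq_smul h' hu hd
  obtain ⟨ε', hε', hN'⟩ := h''.eventuallyEq_smul h' hu hd
  have hεne : ε ≠ 0 := left_ne_zero_of_mul_eq_one hε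
  refine ⟨h, hu, fun X hX hNX => hfront X hX ?_, η, hη0, ?_⟩
  · rw [hN.fderiv_eq, fderiv_fun_const_smul (h'.differentiableAt hu)] at hNX
    rw [hN'.fderiv_eq, fderiv_fun_const_smul (h'.differentiableAt hu)]
    have : fderiv ℝ N' u X = 0 := by simpa [hεne] using hNX
    simp [this]
  · have hj : jacobian F N =ᶠ[𝓝 u] fun v => ε * jacobian F N' v := by
      filter_upwards [hN] with v hv
      rw [jacobian, hv, coorientForm_smul_normal]
      rfl
    rw [hj.fderiv_eq, fderiv_const_mul (h'.differentiableAt_jacobian hu)]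
    simp [hεne, hη]

end NullDirections

/-! ### Vanishing of the second fundamental form at A₂-points. -/

section SingularPoints

variable {m : ℕ}

/-- The numerator `II(X, X) II(Y, Y) - II(X, Y)²` of the Gauss equation. -/
noncomputable def curvNum (F N : Euc m → Euc (m + 1)) (u X Y : Euc m) : ℝ :=
  sff F N u X X * sff F N u Y Y - sff F N u X Y ^ 2

/-- The Gram determinant of `dF(X)` and `dF(Y)`. -/
noncomputable def gramDet (F : Euc m → Euc (m + 1)) (u X Y : Euc m) : ℝ :=
  inner ℝ (fderiv ℝ F u X) (fderiv ℝ F u X) * inner ℝ (fderiv ℝ F u Y) (fderiv ℝ F u Y) -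
    inner ℝ (fderiv ℝ F u X) (fderiv ℝ F u Y) ^ 2

theorem gramDet_nonneg (F : Euc m → Euc (m + 1)) (u X Y : Euc m) : 0 ≤ gramDet F u X Y := by
  have := real_inner_mul_inner_self_le (fderiv ℝ F u X) (fderiv ℝ F u Y)
  rw [gramDet]
  nlinarith

/-- The product of the difference quotients is a(t) b(t) / t², which is non-negative for t ≠ 0 near
0. -/
theorem mul_nonneg_of_hasDerivAt {a b : ℝ → ℝ} {a' b' : ℝ} (ha : HasDerivAt a a' 0)
    (hb : HasDerivAt b b' 0) (ha0 : a 0 = 0) (hb0 : b 0 = 0)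
    (hab : ∀ᶠ t in 𝓝[≠] 0, 0 ≤ a t * b t) : 0 ≤ a' * b' := by
  refine ge_of_tendsto ((hasDerivAt_iff_tendsto_slope.1 ha).mul
    (hasDerivAt_iff_tendsto_slope.1 hb)) ?_
  filter_upwards [hab] with t ht
  simp only [slope, vsub_eq_sub, ha0, hb0, sub_zero, smul_eq_mul]
  nlinarith [mul_nonneg (mul_self_nonneg t⁻¹) ht]

/-- The derivative along a line of a function of several variables. -/
theorem hasDerivAt_line {g : Euc m → ℝ} {u : Euc m} (hg : DifferentiableAt ℝ g u) (v : Euc m) :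
    HasDerivAt (fun t : ℝ => g (u + t • v)) (fderiv ℝ g u v) 0 := by
  have h1 : HasDerivAt (fun t : ℝ => u + t • v) v 0 := by
    simpa using ((hasDerivAt_id (0 : ℝ)).smul_const v).const_add u
  have h2 : HasFDerivAt g (fderiv ℝ g u) (u + (0 : ℝ) • v) := by simpa using hg.hasFDerivAt
  exact h2.comp_hasDerivAt 0 h1

namespace IsNormalAlong

variable {F N : Euc m → Euc (m + 1)} {Ω : Set (Euc m)} {u : Euc m}

theorem differentiableAt_sff (h : IsNormalAlong F N Ω) (hu : u ∈ Ω) (X Y : Euc m) :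
    DifferentiableAt ℝ (fun v => sff F N v X Y) u :=
  ((h.differentiableAt_fderiv_map_apply hu X).inner ℝ
    (h.differentiableAt_fderiv_apply hu Y)).neg

theorem fderiv_sff_of_null (h : IsNormalAlong F N Ω) (hu : u ∈ Ω) {X : Euc m}
    (hX : fderiv ℝ F u X = 0) (Y Z : Euc m) :
    fderiv ℝ (fun v => sff F N v X Y) u Z =
      -inner ℝ (fderiv ℝ (fderiv ℝ F) u Z X) (fderiv ℝ N u Y) := by
  simp only [sff]
  rw [fderiv_fun_neg, neg_apply,
    fderiv_inner_apply ℝ (h.differentiableAt_fderiv_map_apply hu X)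
      (h.differentiableAt_fderiv_apply hu Y), h.fderiv_fderiv_map_apply hu, hX]
  simp

theorem sff_null (h : IsNormalAlong F N Ω) (hu : u ∈ Ω) {η : Euc m} (hη : fderiv ℝ F u η = 0)
    (X : Euc m) : sff F N u X η = 0 := by
  rw [h.sff_symm hu, sff, hη, inner_zero_left, neg_zero]

/-- Curvature hypotheses speak only of regular points; this makes them available on a punctured line
through a singular point, along a direction in which the signed Jacobian has a simple zero. -/
theorem line_mem_regular (h : IsNormalAlong F N Ω) (hu : u ∈ Ω) {η : Euc m}
    (hη : fderiv ℝ (jacobian F N) u η ≠ 0) :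
    ∀ᶠ t in 𝓝[≠] (0 : ℝ), u + t • η ∈ Ω ∧ Function.Injective (fderiv ℝ F (u + t • η)) := by
  have h1 : ∀ᶠ t in 𝓝 (0 : ℝ), u + t • η ∈ Ω := by
    have hc : ContinuousAt (fun t : ℝ => u + t • η) 0 := by fun_prop
    exact hc.eventually (by simpa using h.mem_nhds hu)
  by_cases h0 : jacobian F N u = 0
  · have h2 := (hasDerivAt_line (h.differentiableAt_jacobian hu) η).eventually_ne hη (c := 0)
    filter_upwards [h1.filter_mono nhdsWithin_le_nhds, h2] with t ht ht'
      using ⟨ht, (h.jacobian_ne_zero_iff ht).1 ht'⟩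
  · have h2 : ∀ᶠ t in 𝓝 (0 : ℝ), jacobian F N (u + t • η) ≠ 0 :=
      (hasDerivAt_line (h.differentiableAt_jacobian hu) η).continuousAt.eventually_ne
        (by simpa using h0)
    filter_upwards [h1.filter_mono nhdsWithin_le_nhds, h2.filter_mono nhdsWithin_le_nhds]
      with t ht ht' using ⟨ht, (h.jacobian_ne_zero_iff ht).1 ht'⟩

end IsNormalAlong

namespace IsCuspidal

variable {F N : Euc m → Euc (m + 1)} {Ω : Set (Euc m)} {u : Euc m}

/-- The second fundamental form grows linearly in the null direction. -/
theorem inner_fderiv_null_ne_zero (h : IsCuspidal F N Ω u) {η : Euc m}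
    (hη0 : fderiv ℝ F u η = 0) (hη : fderiv ℝ (jacobian F N) u η ≠ 0) :
    inner ℝ (fderiv ℝ (fderiv ℝ F) u η η) (fderiv ℝ N u η) ≠ 0 := by
  intro h0
  have hne : η ≠ 0 := by rintro rfl; simp at hη
  apply hne
  refine h.front η hη0 ?_
  obtain ⟨b, j, hb, rfl⟩ := exists_basis_apply_eq hne
  have hdet := h.isNormal.vecDet_mul_fderiv_jacobian h.mem hη0 (b j)
  -- F_ηη, the dF(bᵢ) with i ≠ j, and N form a basis because dλ(η) ≠ 0. The vector dN(η) is
  -- orthogonal to N, to dF(bᵢ) by symmetry of II, and by assumption to F_ηη, so it vanishes.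
  refine eq_zero_of_inner_eq_zero (hdet ▸ mul_ne_zero hb hη) (fun i => ?_)
    (h.isNormal.inner_fderiv_self h.mem _)
  by_cases hi : i = j
  · subst hi
    rwa [Function.update_self, real_inner_comm]
  · rw [Function.update_of_ne hi, real_inner_comm, ← neg_eq_zero]
    exact h.isNormal.sff_null h.mem hη0 (b i)

/-- If the sectional curvature is bounded from below near an `A₂`-point, then the second
fundamental form vanishes there. -/
theorem sff_eq_zero (h : IsCuspidal F N Ω u) {C : ℝ}
    (hC : ∀ v ∈ Ω, Function.Injective (fderiv ℝ F v) → ∀ X Y,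
      0 ≤ curvNum F N v X Y + C * gramDet F v X Y) (X Y : Euc m) : sff F N u X Y = 0 := by
  have hn := h.isNormal
  have hu := h.mem
  obtain ⟨η, hη0, hη⟩ := h.null
  have hdiag : ∀ X, sff F N u X X = 0 := by
    intro X
    have ha := hasDerivAt_line (hn.differentiableAt_sff hu X X) η
    have hb := hasDerivAt_line (hn.differentiableAt_sff hu η η) η
    have hc := hasDerivAt_line (hn.differentiableAt_sff hu X η) η
    have hDd : DifferentiableAt ℝ (fun v => gramDet F v X η) u := by
      have h1 := hn.differentiableAt_fderiv_map_apply hu X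
      have h2 := hn.differentiableAt_fderiv_map_apply hu η
      exact ((h1.inner ℝ h1).mul (h2.inner ℝ h2)).sub ((h1.inner ℝ h2).pow 2)
    have hD := hasDerivAt_line hDd η
    have hD0 : gramDet F u X η = 0 := by simp [gramDet, hη0]
    -- The Gram determinant has a minimum at u, so it contributes nothing to first order, whatever C
    -- is.
    have hD' : fderiv ℝ (fun v => gramDet F v X η) u η = 0 := by
      refine IsLocalMin.hasDerivAt_eq_zero (Eventually.of_forall fun t => ?_) hD
      simpa [hD0] using gramDet_nonneg F (u + t • η) X η
    have hG := ((ha.fun_mul hb).fun_sub (hc.fun_pow 2)).fun_add (hD.const_mul C)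
    have hb0 := hn.sff_null hu hη0 η
    have hc0 := hn.sff_null hu hη0 X
    have hmin : IsLocalMin (fun t : ℝ => sff F N (u + t • η) X X * sff F N (u + t • η) η η -
        sff F N (u + t • η) X η ^ 2 + C * gramDet F (u + t • η) X η) 0 := by
      have h1 := eventually_nhdsWithin_iff.1 (hn.line_mem_regular hu hη)
      filter_upwards [h1] with t ht
      by_cases ht0 : t = 0
      · rw [ht0]
      · have h2 := hC _ (ht ht0).1 (ht ht0).2 X η
        simpa [hb0, hc0, hD0, curvNum] using h2
    have hz := hmin.hasDerivAt_eq_zero hG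
    rw [hn.fderiv_sff_of_null hu hη0, hD'] at hz
    simp only [zero_smul, add_zero, hb0, hc0, mul_zero, zero_add] at hz
    have hβ := h.inner_fderiv_null_ne_zero hη0 hη
    simpa [hβ] using hz
  -- Polarisation of the symmetric form.
  have hadd : sff F N u (X + Y) (X + Y) =
      sff F N u X X + sff F N u X Y + (sff F N u Y X + sff F N u Y Y) := by
    simp only [sff, map_add, inner_add_left, inner_add_right]
    ring
  rw [hdiag, hdiag, hdiag, hn.sff_symm hu Y X] at hadd
  linarith

end IsCuspidal

end SingularPoints

/-! ### The sign of the singular principal curvatures. -/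

section SingularShapeOperator

variable {m : ℕ}

theorem forall_snocFrame {V : Type*} {e : Fin (m - 1) → V} {x : V} {p : V → Prop}
    (he : ∀ i, p (e i)) (hx : p x) (j : Fin m) : p (snocFrame e x j) := by
  rw [snocFrame]
  split_ifs with h
  exacts [he _, hx]

theorem snocFrame_comp {V W : Type*} (g : V → W) (e : Fin (m - 1) → V) (x : V) :
    (fun j => g (snocFrame (m := m) e x j)) = snocFrame (fun i => g (e i)) (g x) := by
  ext1 j
  simp only [snocFrame]
  split_ifs <;> rfl

theorem update_snocFrame {V : Type*} (hm : 0 < m) (e : Fin (m - 1) → V) (x y : V) :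
    Function.update (snocFrame e x) ⟨m - 1, by omega⟩ y = snocFrame e y := by
  ext1 j
  by_cases hj : j = ⟨m - 1, by omega⟩
  · subst hj; simp [snocFrame]
  · have : (j : ℕ) < m - 1 := by
      have h1 := j.2
      have h2 : (j : ℕ) ≠ m - 1 := fun h => hj (Fin.ext h)
      omega
    rw [Function.update_of_ne hj]
    simp [snocFrame, this]

theorem snocFrame_last {V : Type*} (hm : 0 < m) (e : Fin (m - 1) → V) (x : V) :
    snocFrame (m := m) e x ⟨m - 1, by omega⟩ = x := by
  simp [snocFrame]

namespace IsConormalFrame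

variable {F N n : Euc m → Euc (m + 1)} {W : Set (Euc m)} {e : Fin (m - 1) → Euc m → Euc m}
  {u : Euc m}

/-- The orthogonal complement of `dF(e₁), …, dF(eₘ₋₁), N` is spanned by the conormal vector. -/
theorem eq_smul_conormal (h : IsConormalFrame F N W e n) (hu : u ∈ W) {z : Euc (m + 1)}
    (he : ∀ i, inner ℝ z (fderiv ℝ F u (e i u)) = 0) (hN : inner ℝ z (N u) = 0) :
    z = inner ℝ z (n u) • n u := by
  refine sub_eq_zero.1 (eq_zero_of_inner_eq_zero (h.positive u hu).ne'
    (forall_snocFrame (p := fun x => inner ℝ (z - inner ℝ z (n u) • n u) x = 0) ?_ ?_) ?_)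
  · intro i
    simp only [inner_sub_left, inner_smul_left, he i, h.inner_n_e u hu i, mul_zero, sub_zero]
  · simp [inner_sub_left, inner_smul_left, h.norm_n u hu]
  · simp only [inner_sub_left, inner_smul_left, hN, h.inner_n_normal u hu, mul_zero, sub_zero]

/-- The left side is linear in z and vanishes on dF(eᵢ) and N, so the vector representing it is a
multiple of n. -/
theorem coorientForm_snocFrame (h : IsConormalFrame F N W e n) (hu : u ∈ W) (hm : 0 < m)
    (z : Euc (m + 1)) :
    coorientForm (N u) (snocFrame (fun i => fderiv ℝ F u (e i u)) z) = inner ℝ z (n u) *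
      coorientForm (N u) (snocFrame (fun i => fderiv ℝ F u (e i u)) (n u)) := by
  set v : Fin (m - 1) → Euc (m + 1) := fun i => fderiv ℝ F u (e i u) with hv
  let φ : Euc (m + 1) →L[ℝ] ℝ := LinearMap.toContinuousLinearMap
    ((coorientAlternating (N u)).toMultilinearMap.toLinearMap (snocFrame v 0) ⟨m - 1, by omega⟩)
  have hφ : ∀ z, φ z = coorientForm (N u) (snocFrame v z) := by
    intro z
    change coorientAlternating (N u) (Function.update (snocFrame v 0) ⟨m - 1, by omega⟩ z) = _
    rw [update_snocFrame hm, coorientAlternating_apply]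
  obtain ⟨w, hw⟩ : ∃ w, ∀ z, φ z = inner ℝ w z :=
    ⟨(InnerProductSpace.toDual ℝ _).symm φ, fun z => by simp⟩
  have hwe : ∀ i, inner ℝ w (v i) = 0 := by
    intro i
    rw [← hw, hφ]
    have hne : (⟨i, by omega⟩ : Fin m) ≠ ⟨m - 1, by omega⟩ := by
      have := i.2
      intro h
      simp at h
      omega
    refine (coorientAlternating (N u)).map_eq_zero_of_eq _ ?_ hne
    simp [snocFrame]
  have hwN : inner ℝ w (N u) = 0 := by
    rw [← hw, hφ, coorientForm, vecDet]
    refine Matrix.det_zero_of_row_eq (i := Fin.castSucc ⟨m - 1, by omega⟩) (j := Fin.last m)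
      (Fin.castSucc_lt_last _).ne ?_
    ext k
    simp only [Matrix.of_apply, Fin.snoc_castSucc, Fin.snoc_last, snocFrame_last hm]
  have hwn := h.eq_smul_conormal hu hwe hwN
  rw [← hφ, ← hφ, hw, hw]
  conv_lhs => rw [hwn, inner_smul_left, real_inner_comm z (n u)]
  simp [mul_comm]

end IsConormalFrame

/-- This plays the role of the Codazzi equation: the third-derivative term is symmetric, so
derivatives of II in different directions can be compared. -/
theorem IsNormalAlong.fderiv_sff {F N : Euc m → Euc (m + 1)} {Ω : Set (Euc m)} {u : Euc m}
    (h : IsNormalAlong F N Ω) (hu : u ∈ Ω) (Y Z T : Euc m) :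
    fderiv ℝ (fun v => sff F N v Z Y) u T =
      inner ℝ (fderiv ℝ (fderiv ℝ (fderiv ℝ F)) u T Y Z) (N u) +
        inner ℝ (fderiv ℝ (fderiv ℝ F) u Y Z) (fderiv ℝ N u T) := by
  have hd : DifferentiableAt ℝ (fderiv ℝ (fderiv ℝ F)) u :=
    (h.contDiffAt_fderiv_fderiv_map hu).differentiableAt (by simp)
  have hdY := hd.clm_apply (differentiableAt_const Y)
  have hev : (fun v => sff F N v Z Y) =ᶠ[𝓝 u]
      fun v => inner ℝ (fderiv ℝ (fderiv ℝ F) v Y Z) (N v) := by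
    filter_upwards [h.mem_nhds hu] with v hv using h.sff_eq hv Z Y
  have h1 : fderiv ℝ (fun v => fderiv ℝ (fderiv ℝ F) v Y Z) u T =
      fderiv ℝ (fderiv ℝ (fderiv ℝ F)) u T Y Z := by
    rw [fderiv_clm_apply hdY (differentiableAt_const Z),
      fderiv_clm_apply hd (differentiableAt_const Y)]
    simp
  rw [hev.fderiv_eq, fderiv_inner_apply ℝ (hdY.clm_apply (differentiableAt_const Z))
    (h.differentiableAt hu), h1, add_comm]

theorem IsCuspidal.singular_curvature_nonpos {F N : Euc m → Euc (m + 1)} {Ω : Set (Euc m)}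
    {u : Euc m} (h : IsCuspidal F N Ω u) (hII : ∀ X Y, sff F N u X Y = 0)
    (hK : ∀ v ∈ Ω, Function.Injective (fderiv ℝ F v) → ∀ X Y, 0 ≤ curvNum F N v X Y)
    {W : Set (Euc m)} {e : Fin (m - 1) → Euc m → Euc m} {n : Euc m → Euc (m + 1)} {η X : Euc m}
    (hW : IsOpen W) (huW : u ∈ W) (hf : IsConormalFrame F N W e n) (hη0 : fderiv ℝ F u η = 0)
    (hpos : 0 < vecDet (snocFrame (fun i => e i u) η))
    (hX : fderiv ℝ (jacobian F N) u X = 0) (hX0 : X ≠ 0) {κ : ℝ}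
    (hS : fderiv ℝ F u (κ • X) =
      -(Real.sign (fderiv ℝ (jacobian F N) u η) • tangentialDeriv N n u X)) : κ ≤ 0 := by
  have hn := h.isNormal
  have hu := h.mem
  obtain ⟨η', hη'0, hη'⟩ := h.null
  have hm : 0 < m := by
    rcases Nat.eq_zero_or_pos m with rfl | hm
    · exact absurd (Subsingleton.elim X 0) hX0
    · exact hm
  set b : Fin m → Euc m := snocFrame (fun i => e i u) η with hb
  have hbη : b ⟨m - 1, by omega⟩ = η := snocFrame_last hm _ _
  have hηne : η ≠ 0 := by
    rw [← hbη]; exact ((vecDet_ne_zero_iff b).1 hpos.ne').ne_zero _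
  have hη : fderiv ℝ (jacobian F N) u η ≠ 0 := by
    obtain ⟨c, rfl⟩ := hn.exists_eq_smul_of_null hu hη'0 hη' hη0
    have hc : c ≠ 0 := by rintro rfl; simp at hηne
    simp [hc, hη']
  have hsing := hn.jacobian_eq_zero hu hηne hη0
  set P := coorientForm (N u) (snocFrame (fun i => fderiv ℝ F u (e i u)) (n u)) with hP
  have hPpos : 0 < P := hf.positive u huW
  -- the derivative of the signed Jacobian in terms of the conormal component
  have hdJ : ∀ v, vecDet b * fderiv ℝ (jacobian F N) u v =
      inner ℝ (fderiv ℝ (fderiv ℝ F) u v η) (n u) * P := by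
    intro v
    have h1 := hn.vecDet_mul_fderiv_jacobian hu (b := b) (j := ⟨m - 1, by omega⟩)
      (by rw [hbη, hη0]) v
    rw [hbη, hb, snocFrame_comp (fderiv ℝ F u), update_snocFrame hm,
      hf.coorientForm_snocFrame huW hm] at h1
    exact h1
  have hnull : ∀ L : Euc m →ₗ[ℝ] ℝ, (∀ i, L (e i u) = 0) → L η = 0 → L = 0 := fun L h1 h2 =>
    eq_zero_of_apply_eq_zero hpos.ne' (forall_snocFrame (p := fun x => L x = 0) h1 h2)
  -- the conormal vector is orthogonal to the image of the differential
  have hnF : ∀ Z, inner ℝ (n u) (fderiv ℝ F u Z) = 0 := by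
    intro Z
    exact DFunLike.congr_fun (hnull ((innerSL ℝ (n u)).toLinearMap ∘ₗ (fderiv ℝ F u).toLinearMap)
      (fun i => by simpa using hf.inner_n_e u huW i) (by simp [hη0])) Z
  have hdN : ∀ Z, fderiv ℝ N u Z = inner ℝ (fderiv ℝ N u Z) (n u) • n u := by
    intro Z
    refine hf.eq_smul_conormal huW (fun i => ?_) (hn.inner_fderiv_self hu Z)
    rw [real_inner_comm, ← neg_eq_zero]
    exact hII (e i u) Z
  set c := inner ℝ (fderiv ℝ N u η) (n u) with hc
  have hdNη : fderiv ℝ N u η = c • n u := hdN η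
  -- If c = 0, both dF and dN would kill η, against the front condition.
  have hcne : c ≠ 0 := by
    intro h0
    exact hηne (h.front η hη0 (by rw [hdNη, h0, zero_smul]))
  -- the second derivative in terms of the derivative of the conormal vector
  have hXX : inner ℝ (fderiv ℝ (fderiv ℝ F) u X X) (n u) =
      -inner ℝ (fderiv ℝ F u X) (fderiv ℝ n u X) := by
    have hWn : W ∈ 𝓝 u := hW.mem_nhds huW
    have hnd : DifferentiableAt ℝ n u := (hf.smooth_n.contDiffAt hWn).differentiableAt (by simp)
    let ψ : Euc m →ₗ[ℝ] ℝ := ((innerSL ℝ (n u)).toLinearMap ∘ₗ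
      (fderiv ℝ (fderiv ℝ F) u X).toLinearMap) + ((innerSL ℝ (fderiv ℝ n u X)).toLinearMap ∘ₗ
        (fderiv ℝ F u).toLinearMap)
    have hψ : ∀ Y, ψ Y = inner ℝ (n u) (fderiv ℝ (fderiv ℝ F) u X Y) +
        inner ℝ (fderiv ℝ n u X) (fderiv ℝ F u Y) := fun Y => rfl
    have hψe : ∀ i, ψ (e i u) = 0 := by
      intro i
      have hed : DifferentiableAt ℝ (e i) u :=
        ((hf.smooth_e i).contDiffAt hWn).differentiableAt (by simp)
      have hev : (fun v => inner ℝ (n v) (fderiv ℝ F v (e i v))) =ᶠ[𝓝 u] fun _ => (0 : ℝ) := by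
        filter_upwards [hWn] with v hv using hf.inner_n_e v hv i
      have h1 := fderiv_inner_apply ℝ hnd ((hn.differentiableAt_fderiv_map hu).clm_apply hed) X
      rw [hev.fderiv_eq, fderiv_clm_apply (hn.differentiableAt_fderiv_map hu) hed] at h1
      -- The term ⟨n, dF(∂_X eᵢ)⟩ disappears since n is orthogonal to the image of dF at u; hence no
      -- control of the derivative of eᵢ is needed.
      simp only [fderiv_fun_const, Pi.zero_apply, zero_apply, add_apply,
        ContinuousLinearMap.comp_apply, ContinuousLinearMap.flip_apply, inner_add_right,
        hnF, zero_add] at h1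
      rw [hψ]
      exact h1.symm
    let μ : Euc m →ₗ[ℝ] ℝ := (fderiv ℝ (jacobian F N) u).toLinearMap
    have hμ : ∀ Y, μ Y = fderiv ℝ (jacobian F N) u Y := fun Y => rfl
    -- Both ψ and dλ vanish on e₁, …, eₘ₋₁, hence ψ is a multiple of dλ and vanishes on X.
    have h1 := hnull (ψ - (ψ η / μ η) • μ) (fun i => by
      have : μ (e i u) = 0 := hf.tangent_e i u huW hsing
      simp [hψe i, this]) (by
      have : μ η ≠ 0 := hη
      simp [this])
    have h2 := DFunLike.congr_fun h1 X
    have h3 : ψ X = 0 := by simpa [hμ, hX] using h2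
    rw [hψ, real_inner_comm, real_inner_comm (fderiv ℝ F u X)] at h3
    linarith
  -- the derivative of the second fundamental form in the null direction
  have hDsff : fderiv ℝ (fun v => sff F N v X X) u η =
      c * inner ℝ (fderiv ℝ (fderiv ℝ F) u X X) (n u) := by
    have hsymm : IsSymmSndFDerivAt ℝ (fderiv ℝ F) u :=
      (hn.contDiffAt_fderiv_map hu).isSymmSndFDerivAt (by simpa using two_le_infty)
    -- As dλ(X) = 0, the vector F_Xη has no conormal component, while dN(X) is a multiple of n. This
    -- removes the third-derivative term below.
    have hXη : inner ℝ (fderiv ℝ (fderiv ℝ F) u X η) (fderiv ℝ N u X) = 0 := by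
      have h1 := hdJ X
      rw [hX, mul_zero, eq_comm, mul_eq_zero, or_iff_left hPpos.ne'] at h1
      rw [hdN X, inner_smul_right, h1, mul_zero]
    have h1 := hn.fderiv_sff hu X X η
    have h2 := hn.fderiv_sff hu η X X
    have h3 : fderiv ℝ (fun v => sff F N v X η) u X = 0 := by
      have hev : (fun v => sff F N v X η) =ᶠ[𝓝 u] fun v => sff F N v η X := by
        filter_upwards [hn.mem_nhds hu] with v hv using hn.sff_symm hv X η
      rw [hev.fderiv_eq, hn.fderiv_sff_of_null hu hη0, hXη, neg_zero]
    rw [h3, hn.fderiv_fderiv_symm hu η X, hXη, add_zero] at h2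
    rw [h1, hsymm.eq η X, ← h2, zero_add, hdNη, inner_smul_right]
  -- the sign of the curvature
  have hprod := mul_nonneg_of_hasDerivAt (hasDerivAt_line (hn.differentiableAt_sff hu X X) η)
    (hasDerivAt_line (hn.differentiableAt_sff hu η η) η) (by simpa using hII X X)
    (by simpa using hII η η) (by
      filter_upwards [hn.line_mem_regular hu hη] with t ht
      have h1 := hK _ ht.1 ht.2 X η
      rw [curvNum] at h1
      nlinarith [sq_nonneg (sff F N (u + t • η) X η)])
  rw [hDsff, hn.fderiv_sff_of_null hu hη0, hdNη, inner_smul_right, hXX] at hprod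
  set A := inner ℝ (fderiv ℝ F u X) (fderiv ℝ n u X) with hA
  set l := fderiv ℝ (jacobian F N) u η with hl
  set D := inner ℝ (fderiv ℝ (fderiv ℝ F) u η η) (n u) with hD
  -- Since `vecDet b` and P are positive, dλ(η) and ⟨F_ηη, n⟩ have the same sign.
  have hlD : vecDet b * l = D * P := hdJ η
  have hAD : 0 ≤ A * D := by
    have h1 : 0 ≤ (c * c) * (A * D) := by nlinarith
    exact nonneg_of_mul_nonneg_right h1 (mul_self_pos.2 hcne)
  have hAl : 0 ≤ A * l := by
    have h1 : 0 ≤ vecDet b * (A * l) := by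
      have : vecDet b * (A * l) = (A * D) * P := by rw [mul_left_comm, hlD]; ring
      rw [this]
      exact mul_nonneg hAD hPpos.le
    exact nonneg_of_mul_nonneg_right h1 hpos
  have hAs : 0 ≤ Real.sign l * A := by
    rcases lt_or_gt_of_ne hη with hneg | hpos'
    · rw [Real.sign_of_neg hneg]
      nlinarith
    · rw [Real.sign_of_pos hpos']
      nlinarith
  have hin := congrArg (fun z => inner ℝ (fderiv ℝ F u X) z) hS
  simp only [map_smul, inner_smul_right, inner_neg_right, tangentialDeriv, inner_sub_right,
    hn.normal u hu, mul_zero, sub_zero] at hin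
  have hFX : fderiv ℝ F u X ≠ 0 := by
    intro h0
    obtain ⟨a, rfl⟩ := hn.exists_eq_smul_of_null hu hη0 hη h0
    have ha : a ≠ 0 := by rintro rfl; simp at hX0
    simp [ha] at hX
    exact hη hX
  have hsq : 0 < inner ℝ (fderiv ℝ F u X) (fderiv ℝ F u X) := real_inner_self_pos.2 hFX
  by_contra hκ
  have := mul_pos (not_le.1 hκ) hsq
  linarith

end SingularShapeOperator

/-! ### Division by the Jacobian, uniform injectivity, and the regular case of boundedness. -/

section Boundedness

variable {m : ℕ}

/-- A `C¹` function that vanishes on the zero set of a function `J` with `dJ ≠ 0` is bounded by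
a multiple of `J`. -/
theorem exists_norm_le_mul_of_vanish {V E : Type*} [NormedAddCommGroup V] [NormedSpace ℝ V]
    [NormedAddCommGroup E] [NormedSpace ℝ E] {J : V → ℝ} {ψ : V → E} {u : V}
    (hJ : ContDiffAt ℝ 1 J u) (hψ : ContDiffAt ℝ 1 ψ u) (hJ0 : J u = 0)
    (hd : fderiv ℝ J u ≠ 0) (hz : ∀ᶠ v in 𝓝 u, J v = 0 → ψ v = 0) :
    ∃ C : ℝ, ∀ᶠ v in 𝓝 u, ‖ψ v‖ ≤ C * |J v| := by
  obtain ⟨v₀, hv₀⟩ : ∃ v, fderiv ℝ J u v = 1 := by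
    obtain ⟨w, hw⟩ : ∃ w, fderiv ℝ J u w ≠ 0 := by
      by_contra! hc
      exact hd (ContinuousLinearMap.ext hc)
    exact ⟨(fderiv ℝ J u w)⁻¹ • w, by simp [hw]⟩
  have hv₀pos : 0 < ‖v₀‖ := norm_pos_iff.2 (by rintro rfl; simp at hv₀)
  obtain ⟨K, s, hs, hK⟩ := hψ.exists_lipschitzOnWith
  -- With this constant the error of the linear approximation along a • v₀ is at most |a| / 2, so J
  -- changes at rate at least 1/2 along v₀.
  have hstrict := (hJ.hasStrictFDerivAt (by simp)).isLittleO.def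
    (show (0 : ℝ) < (2 * ‖v₀‖)⁻¹ by positivity)
  rw [nhds_prod_eq, eventually_prod_self_iff'] at hstrict
  obtain ⟨t, ht, hstrict⟩ := hstrict
  have hcont : ∀ᶠ v in 𝓝 u, ContinuousAt J v :=
    (hJ.eventually (by simp)).mono fun v hv => hv.continuousAt
  obtain ⟨r, hr, hball⟩ := Metric.mem_nhds_iff.1 (inter_mem (inter_mem hs ht)
    (inter_mem hz hcont))
  refine ⟨K * (2 * ‖v₀‖), ?_⟩
  have hsmall : ∀ᶠ v in 𝓝 u, 2 * |J v| * ‖v₀‖ < r / 2 := by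
    have hc : ContinuousAt (fun v => 2 * |J v| * ‖v₀‖) u := by
      have := hJ.continuousAt
      fun_prop
    have h0 : 2 * |J u| * ‖v₀‖ < r / 2 := by simp [hJ0, hr]
    exact hc.eventually (Iio_mem_nhds h0)
  filter_upwards [Metric.ball_mem_nhds u (half_pos hr), hsmall] with v hv hv'
  -- At rate 1/2, a segment of half-length 2|J v| is long enough to reach a zero of J; the Lipschitz
  -- bound for ψ is then applied between v and that zero.
  set τ := 2 * |J v| with hτ
  have hτ0 : 0 ≤ τ := by positivity
  have hmem : ∀ a ∈ Icc (-τ) τ, v + a • v₀ ∈ Metric.ball u r := by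
    intro a ha
    rw [Metric.mem_ball] at hv ⊢
    calc dist (v + a • v₀) u ≤ dist (v + a • v₀) v + dist v u := dist_triangle _ _ _
      _ < r / 2 + r / 2 := by
        refine add_lt_add_of_le_of_lt ?_ hv
        rw [dist_eq_norm, add_sub_cancel_left, norm_smul, Real.norm_eq_abs]
        refine le_trans ?_ hv'.le
        gcongr
        exact abs_le.2 ha
      _ = r := add_halves r
  have hvmem : v ∈ Metric.ball u r := by simpa using hmem 0 ⟨by linarith, hτ0⟩
  have hest : ∀ a ∈ Icc (-τ) τ, |J (v + a • v₀) - J v - a| ≤ |a| / 2 := by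
    intro a ha
    have h1 := hstrict (v + a • v₀) (hball (hmem a ha)).1.2 v (hball hvmem).1.2
    simp only [add_sub_cancel_left, map_smul, hv₀, smul_eq_mul, mul_one, norm_smul,
      Real.norm_eq_abs] at h1
    refine h1.trans (le_of_eq ?_)
    field_simp
  have hcontOn : ContinuousOn (fun a : ℝ => J (v + a • v₀)) (Icc (-τ) τ) := by
    intro a ha
    have h1 : ContinuousAt J (v + a • v₀) := (hball (hmem a ha)).2.2
    have h2 : ContinuousAt (fun a : ℝ => v + a • v₀) a := by fun_prop
    exact (ContinuousAt.comp (f := fun a : ℝ => v + a • v₀) h1 h2).continuousWithinAt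
  have hle : -τ ≤ τ := by linarith
  obtain ⟨a, ha, ha0⟩ : (0 : ℝ) ∈ (fun a : ℝ => J (v + a • v₀)) '' Icc (-τ) τ := by
    refine intermediate_value_Icc hle hcontOn ⟨?_, ?_⟩
    · have h1 := abs_le.1 (hest (-τ) ⟨le_rfl, hle⟩)
      rw [abs_neg, abs_of_nonneg hτ0] at h1
      have h2 := le_abs_self (J v)
      linarith [h1.2]
    · have h1 := abs_le.1 (hest τ ⟨hle, le_rfl⟩)
      rw [abs_of_nonneg hτ0] at h1
      have h2 := neg_abs_le (J v)
      linarith [h1.1]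
  have hψ0 : ψ (v + a • v₀) = 0 := (hball (hmem a ha)).2.1 ha0
  have hlip := hK.dist_le_mul v (hball hvmem).1.1 _ (hball (hmem a ha)).1.1
  rw [hψ0, dist_zero_right, dist_eq_norm] at hlip
  refine hlip.trans ?_
  have h3 : ‖v - (v + a • v₀)‖ ≤ τ * ‖v₀‖ := by
    rw [sub_add_cancel_left, norm_neg, norm_smul, Real.norm_eq_abs]
    gcongr
    exact abs_le.2 ha
  calc (K : ℝ) * ‖v - (v + a • v₀)‖ ≤ K * (τ * ‖v₀‖) := by gcongr
    _ = K * (2 * ‖v₀‖) * |J v| := by rw [hτ]; ring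

/-- A family of linear maps that is continuous at a point where it is injective is uniformly
bounded below near that point. -/
theorem exists_le_norm_of_injective {T V E : Type*} [TopologicalSpace T]
    [NormedAddCommGroup V] [NormedSpace ℝ V] [FiniteDimensional ℝ V]
    [NormedAddCommGroup E] [NormedSpace ℝ E] {L : T → V →L[ℝ] E} {u : T}
    (hL : ContinuousAt L u) (hi : Function.Injective (L u)) :
    ∃ C : ℝ, 0 < C ∧ ∀ᶠ v in 𝓝 u, ∀ X, ‖X‖ ≤ C * ‖L v X‖ := by
  obtain ⟨K, hK, hA⟩ := (L u : V →ₗ[ℝ] E).exists_antilipschitzWith (LinearMap.ker_eq_bot.2 hi)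
  have hKpos : (0 : ℝ) < K := hK
  refine ⟨2 * K, by positivity, ?_⟩
  have hnear : ∀ᶠ v in 𝓝 u, ‖L v - L u‖ < (2 * (K : ℝ))⁻¹ := by
    have := hL.eventually (Metric.ball_mem_nhds _ (show (0 : ℝ) < (2 * (K : ℝ))⁻¹ by positivity))
    simpa [Metric.mem_ball, dist_eq_norm] using this
  filter_upwards [hnear] with v hv X
  have h1 : ‖X‖ ≤ K * ‖L u X‖ := by simpa using ZeroHomClass.bound_of_antilipschitz _ hA X
  have h2 : ‖L u X‖ ≤ ‖L v X‖ + (2 * (K : ℝ))⁻¹ * ‖X‖ := by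
    have h3 : ‖(L v - L u) X‖ ≤ (2 * (K : ℝ))⁻¹ * ‖X‖ :=
      ((L v - L u).le_opNorm X).trans (by gcongr)
    have h4 : L u X = L v X - (L v - L u) X := by simp
    rw [h4]
    exact (norm_sub_le _ _).trans (by linarith)
  have h5 : (K : ℝ) * ((2 * (K : ℝ))⁻¹ * ‖X‖) = ‖X‖ / 2 := by field_simp
  have h6 := mul_le_mul_of_nonneg_left h2 hKpos.le
  rw [mul_add, h5] at h6
  linarith

theorem gramDet_eq_mul {F : Euc m → Euc (m + 1)} {u X : Euc m} (hX : fderiv ℝ F u X ≠ 0)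
    (Y : Euc m) : gramDet F u X Y = ‖fderiv ℝ F u X‖ ^ 2 *
      ‖fderiv ℝ F u (Y - (inner ℝ (fderiv ℝ F u X) (fderiv ℝ F u Y) /
        inner ℝ (fderiv ℝ F u X) (fderiv ℝ F u X)) • X)‖ ^ 2 := by
  rw [gramDet, map_sub, map_smul]
  set x := fderiv ℝ F u X with hx
  set y := fderiv ℝ F u Y with hy
  have hxx : inner ℝ x x ≠ 0 := fun h0 => hX (inner_self_eq_zero.1 h0)
  rw [← real_inner_self_eq_norm_sq, ← real_inner_self_eq_norm_sq]
  simp only [inner_sub_right, inner_smul_right, inner_sub_left, inner_smul_left,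
    RCLike.conj_to_real]
  rw [real_inner_comm x y]
  field_simp
  ring

/-- The Gauss numerator is unchanged under Y ↦ Y - sX. Choosing s by Gram-Schmidt makes the product
of squared lengths equal to the Gram determinant. -/
theorem abs_curvNum_le_gramDet {F N : Euc m → Euc (m + 1)} {Ω : Set (Euc m)} {u : Euc m}
    (h : IsNormalAlong F N Ω) (hu : u ∈ Ω) {C : ℝ}
    (hC : ∀ X Y, |curvNum F N u X Y| ≤ C * (‖fderiv ℝ F u X‖ ^ 2 * ‖fderiv ℝ F u Y‖ ^ 2))
    (X Y : Euc m) : |curvNum F N u X Y| ≤ C * gramDet F u X Y := by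
  set x := fderiv ℝ F u X with hx
  set y := fderiv ℝ F u Y with hy
  by_cases hx0 : x = 0
  · have h1 := hC X Y
    rw [← hx, hx0] at h1
    refine h1.trans (le_of_eq ?_)
    rw [gramDet, ← hx, hx0]
    simp
  · set s := inner ℝ x y / inner ℝ x x with hs
    have hnum : curvNum F N u X (Y - s • X) = curvNum F N u X Y := by
      have h1 : sff F N u X (Y - s • X) = sff F N u X Y - s * sff F N u X X := by
        simp only [sff, map_sub, map_smul, inner_sub_right, inner_smul_right]
        ring
      have h2 : sff F N u (Y - s • X) (Y - s • X) =
          sff F N u Y Y - s * sff F N u X Y - s * sff F N u X Y + s * s * sff F N u X X := by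
        have h3 := h.sff_symm hu Y X
        simp only [sff, map_sub, map_smul, inner_sub_right, inner_smul_right, inner_sub_left,
          inner_smul_left, RCLike.conj_to_real] at h3 ⊢
        linear_combination -s * h3
      rw [curvNum, curvNum, h1, h2]
      ring
    have hgram : ‖x‖ ^ 2 * ‖fderiv ℝ F u (Y - s • X)‖ ^ 2 = gramDet F u X Y :=
      (gramDet_eq_mul hx0 Y).symm
    rw [← hnum, ← hgram]
    exact hC X _

/-- Near a regular point, the Gauss numerator is bounded by the metric. -/
theorem IsNormalAlong.exists_abs_curvNum_le {F N : Euc m → Euc (m + 1)} {Ω : Set (Euc m)}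
    {u : Euc m} (h : IsNormalAlong F N Ω) (hu : u ∈ Ω) (hi : Function.Injective (fderiv ℝ F u)) :
    ∃ C : ℝ, ∀ᶠ v in 𝓝 u, ∀ X Y, |curvNum F N v X Y| ≤ C * gramDet F v X Y := by
  obtain ⟨A, hA, hA'⟩ := exists_le_norm_of_injective
    (h.contDiffAt_fderiv_map hu).continuousAt hi
  set B := ‖fderiv ℝ N u‖ + 1 with hB
  have hB0 : 0 ≤ B := by positivity
  have hBev : ∀ᶠ v in 𝓝 u, ‖fderiv ℝ N v‖ < B :=
    (h.contDiffAt_fderiv hu).continuousAt.norm.eventually (Iio_mem_nhds (by simp [hB]))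
  refine ⟨2 * (A * B) ^ 2, ?_⟩
  filter_upwards [hA', hBev, h.mem_nhds hu] with v hv hv' hvΩ
  refine abs_curvNum_le_gramDet h hvΩ fun X Y => ?_
  have hsff : ∀ X Y, |sff F N v X Y| ≤ A * B * (‖fderiv ℝ F v X‖ * ‖fderiv ℝ F v Y‖) := by
    intro X Y
    rw [sff, abs_neg]
    calc |inner ℝ (fderiv ℝ F v X) (fderiv ℝ N v Y)|
        ≤ ‖fderiv ℝ F v X‖ * ‖fderiv ℝ N v Y‖ := abs_real_inner_le_norm _ _
      _ ≤ ‖fderiv ℝ F v X‖ * (B * (A * ‖fderiv ℝ F v Y‖)) := by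
        gcongr
        exact ((fderiv ℝ N v).le_opNorm Y).trans (by gcongr; exact hv Y)
      _ = _ := by ring
  set x := ‖fderiv ℝ F v X‖
  set y := ‖fderiv ℝ F v Y‖
  rw [curvNum]
  calc |sff F N v X X * sff F N v Y Y - sff F N v X Y ^ 2|
      ≤ |sff F N v X X| * |sff F N v Y Y| + |sff F N v X Y| ^ 2 := by
        rw [← abs_mul, ← abs_pow]; exact abs_sub _ _
    _ ≤ (A * B * (x * x)) * (A * B * (y * y)) + (A * B * (x * y)) ^ 2 := by
        gcongr
        exacts [hsff X X, hsff Y Y, hsff X Y]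
    _ = 2 * (A * B) ^ 2 * (x ^ 2 * y ^ 2) := by ring

end Boundedness

/-! ### An extended null field by Cramer's rule, and the algebraic estimate of the Gauss numerator.
-/

section CuspidalBoundedness

variable {m : ℕ}

/-- Cramer's rule. -/
theorem sum_coorientForm_smul (ν w : Euc (m + 1)) (v : Fin m → Euc (m + 1)) :
    ∑ j, coorientForm ν (Function.update v j w) • v j + coorientForm w v • ν =
      coorientForm ν v • w := by
  let A : Matrix (Fin (m + 1)) (Fin (m + 1)) ℝ :=
    Matrix.of fun i j => Fin.snoc (α := fun _ => Euc (m + 1)) v ν i j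
  have hrow : ∀ j, (A.updateRow j w).det =
      vecDet (Function.update (Fin.snoc (α := fun _ => Euc (m + 1)) v ν) j w) := by
    intro j
    rw [vecDet]
    congr 1
    ext i k
    by_cases hi : i = j
    · subst hi; simp
    · simp [A, hi, Matrix.updateRow_ne]
  ext k
  have h := congrFun (Matrix.mulVec_cramer A.transpose w) k
  rw [Matrix.det_transpose, Matrix.mulVec, dotProduct, Fin.sum_univ_castSucc] at h
  simp only [Matrix.cramer_transpose_apply, hrow, Fin.update_snoc_last, ← Fin.snoc_update,
    Matrix.transpose_apply] at h
  simpa [A, coorientForm, vecDet, mul_comm] using h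

theorem coorientForm_update_normal (ν : Euc (m + 1)) (v : Fin m → Euc (m + 1)) (j : Fin m) :
    coorientForm ν (Function.update v j ν) = 0 := by
  rw [coorientForm, vecDet]
  refine Matrix.det_zero_of_row_eq (i := Fin.castSucc j) (j := Fin.last m)
    (Fin.castSucc_lt_last _).ne ?_
  ext k
  simp only [Matrix.of_apply, Fin.snoc_castSucc, Fin.snoc_last, Function.update_self]

/-- Near a singular point with a transversal null vector there is a vector field that is mapped by
the differential to a transversal field times the signed Jacobian. -/
theorem IsNormalAlong.exists_null_field {F N : Euc m → Euc (m + 1)} {Ω : Set (Euc m)} {u η : Euc m}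
    (h : IsNormalAlong F N Ω) (hu : u ∈ Ω) (hη0 : fderiv ℝ F u η = 0)
    (hη : fderiv ℝ (jacobian F N) u η ≠ 0) :
    ∃ (ξ : Euc m → Euc m) (φ : Euc m → Euc (m + 1)), ContinuousAt ξ u ∧ ContinuousAt φ u ∧
      (∀ v ∈ Ω, fderiv ℝ F v (ξ v) = jacobian F N v • φ v) ∧ ξ u ≠ 0 ∧
      ∀ X, fderiv ℝ F u X ≠ φ u := by
  have hne : η ≠ 0 := by rintro rfl; simp at hη
  have hJ0 := h.jacobian_eq_zero hu hne hη0
  obtain ⟨b, j, hb, rfl⟩ := exists_basis_apply_eq hne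
  have hdet := h.vecDet_mul_fderiv_jacobian hu hη0 (b j)
  set w := fderiv ℝ (fderiv ℝ F) u (b j) (b j) with hw
  have hcne : coorientForm (N u) (Function.update (fun i => fderiv ℝ F u (b i)) j w) ≠ 0 :=
    hdet ▸ mul_ne_zero hb hη
  -- Cramer's rule for the fixed vector w = F_ηη(u) in the frame dF(b₁), …, dF(bₘ), N: the
  -- tangential coefficients give ξ, and φ is, up to `vecDet b`, the projection of w to N^⊥.
  refine ⟨fun v => ∑ i, coorientForm (N v) (Function.update (fun k => fderiv ℝ F v (b k)) i w) • b i,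
    fun v => vecDet b • (w - inner ℝ w (N v) • N v), ?_, ?_, ?_, ?_, ?_⟩
  · refine tendsto_finsetSum _ fun i _ => Tendsto.smul_const ?_ _
    refine (hasFDerivAt_coorientForm
      (v := fun k v => Function.update (fun k => fderiv ℝ F v (b k)) i w k)
      (fun k => ?_) (h.differentiableAt hu)).1.continuousAt
    by_cases hk : k = i
    · subst hk; simp
    · simpa [hk] using h.differentiableAt_fderiv_map_apply hu (b k)
  · have hN := (h.contDiffAt hu).continuousAt
    have hin : ContinuousAt (fun v => inner ℝ w (N v)) u := continuousAt_const.inner hN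
    fun_prop
  · intro v hv
    have h1 := sum_coorientForm_smul (N v) w fun k => fderiv ℝ F v (b k)
    rw [← jacobian_mul] at h1
    have h2 := congrArg (fun z => inner ℝ z (N v)) h1
    simp only [inner_add_left, sum_inner, inner_smul_left, h.normal v hv, mul_zero,
      Finset.sum_const_zero, zero_add, real_inner_self_eq_norm_sq, h.norm_eq v hv, one_pow,
      mul_one, RCLike.conj_to_real] at h2
    rw [h2] at h1
    rw [map_sum]
    simp only [map_smul]
    rw [eq_sub_of_add_eq h1]
    module
  · change ∑ i, coorientForm (N u) (Function.update (fun k => fderiv ℝ F u (b k)) i w) • b i ≠ 0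
    rw [Finset.sum_eq_single j]
    · exact smul_ne_zero hcne hne
    · intro i _ hi
      rw [coorientForm_eq_zero_of_row_eq_zero _ (i := j), zero_smul]
      rw [Function.update_of_ne hi.symm, hη0]
    · simp
  -- Otherwise w would lie in the span of N and the image of dF, and the determinant would be a
  -- multiple of λ(u) = 0.
  · intro X hX
    apply hcne
    have hwX : w = fderiv ℝ F u ((vecDet b)⁻¹ • X) + inner ℝ w (N u) • N u := by
      rw [map_smul, hX, smul_smul, inv_mul_cancel₀ hb, one_smul, sub_add_cancel]
    have h1 : (Function.update (fun i => fderiv ℝ F u (b i)) j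
        (fderiv ℝ F u ((vecDet b)⁻¹ • X))) =
        fun i => fderiv ℝ F u (Function.update b j ((vecDet b)⁻¹ • X) i) := by
      ext1 i
      by_cases hi : i = j
      · subst hi; simp
      · simp [hi]
    rw [← coorientAlternating_apply, hwX, AlternatingMap.map_update_add,
      AlternatingMap.map_update_smul, coorientAlternating_apply, coorientAlternating_apply,
      coorientForm_update_normal, h1, ← jacobian_mul, hJ0]
    simp

/-- Here J is λ, α = aλ and β = bλ for X = X' + aξ, Y = Y' + bξ; the k's are values of II/λ on X',
Y', and lx, ly, c those of -⟨φ, dN(·)⟩ on X', Y', ξ. The left side is the Gauss numerator after the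
terms in ab²c, a²bc and a²b²c² have cancelled. -/
theorem abs_gauss_numerator_le {J α β c M x y kxx kxy kyy lx ly : ℝ} (hx : 0 ≤ x) (hy : 0 ≤ y)
    (hJ : |J| ≤ 1) (hα : |α| ≤ M * x) (hβ : |β| ≤ M * y) (hc : |c| ≤ M)
    (hkxx : |kxx| ≤ M * (x * x)) (hkxy : |kxy| ≤ M * (x * y)) (hkyy : |kyy| ≤ M * (y * y))
    (hlx : |lx| ≤ M * x) (hly : |ly| ≤ M * y) :
    |J ^ 2 * (kxx * kyy - kxy ^ 2) + 2 * J * β * kxx * ly + β ^ 2 * c * kxx +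
      2 * J * α * kyy * lx + α ^ 2 * c * kyy -
      2 * kxy * (J * β * lx + J * α * ly + α * β * c) - (β * lx - α * ly) ^ 2| ≤
      (2 * M ^ 2 + 8 * M ^ 3 + 8 * M ^ 4) * (x ^ 2 * y ^ 2) := by
  have hM : 0 ≤ M := (abs_nonneg c).trans hc
  calc _ ≤ |J| ^ 2 * (|kxx| * |kyy| + |kxy| ^ 2) + 2 * |J| * |β| * |kxx| * |ly| +
        |β| ^ 2 * |c| * |kxx| + 2 * |J| * |α| * |kyy| * |lx| + |α| ^ 2 * |c| * |kyy| +
        2 * |kxy| * (|J| * |β| * |lx| + |J| * |α| * |ly| + |α| * |β| * |c|) +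
        (|β| * |lx| + |α| * |ly|) ^ 2 := by
        refine (abs_sub _ _).trans (add_le_add ((abs_sub _ _).trans (add_le_add
          ((abs_add_le _ _).trans (add_le_add ((abs_add_le _ _).trans (add_le_add
          ((abs_add_le _ _).trans (add_le_add ((abs_add_le _ _).trans (add_le_add
          ?_ ?_)) ?_)) ?_)) ?_)) ?_)) ?_)
        · rw [abs_mul, abs_pow]
          gcongr
          exact (abs_sub _ _).trans (by rw [abs_mul, abs_pow])
        · simp [abs_mul]
        · simp [abs_mul]
        · simp [abs_mul]
        · simp [abs_mul]
        · rw [abs_mul, abs_mul, abs_two]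
          gcongr
          refine (abs_add_le _ _).trans (add_le_add ((abs_add_le _ _).trans (add_le_add ?_ ?_)) ?_)
          all_goals simp [abs_mul]
        · rw [abs_pow]
          gcongr
          exact (abs_sub _ _).trans (by rw [abs_mul, abs_mul])
    _ ≤ 1 ^ 2 * ((M * (x * x)) * (M * (y * y)) + (M * (x * y)) ^ 2) +
        2 * 1 * (M * y) * (M * (x * x)) * (M * y) + (M * y) ^ 2 * M * (M * (x * x)) +
        2 * 1 * (M * x) * (M * (y * y)) * (M * x) + (M * x) ^ 2 * M * (M * (y * y)) +
        2 * (M * (x * y)) * (1 * (M * y) * (M * x) + 1 * (M * x) * (M * y) +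
          (M * x) * (M * y) * M) + ((M * y) * (M * x) + (M * x) * (M * y)) ^ 2 := by
        gcongr
    _ = _ := by ring

end CuspidalBoundedness

/-! ### Boundedness of the curvature near A₂-points. -/

section CuspidalCurvature

variable {m : ℕ} {F N : Euc m → Euc (m + 1)} {Ω : Set (Euc m)} {u : Euc m}

/-- If the second fundamental form vanishes on the singular set, it is bounded by a multiple of
the signed Jacobian. -/
theorem IsNormalAlong.exists_abs_sff_le (h : IsNormalAlong F N Ω) (hu : u ∈ Ω)
    (hJ0 : jacobian F N u = 0) (hd : fderiv ℝ (jacobian F N) u ≠ 0)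
    (hII : ∀ v ∈ Ω, jacobian F N v = 0 → ∀ X Y, sff F N v X Y = 0) :
    ∃ C : ℝ, 0 ≤ C ∧ ∀ᶠ v in 𝓝 u, ∀ X Y, |sff F N v X Y| ≤ C * |jacobian F N v| * (‖X‖ * ‖Y‖) := by
  let I : Euc (m + 1) →L[ℝ] Euc (m + 1) →L[ℝ] ℝ :=
    (isBoundedBilinearMap_inner (𝕜 := ℝ) (E := Euc (m + 1))).toContinuousLinearMap
  -- II is encoded as a single smooth map into bilinear forms, so that dividing by λ gives a bound
  -- uniform in X and Y.
  let ψ : Euc m → Euc m →L[ℝ] Euc m →L[ℝ] ℝ := fun v =>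
    (ContinuousLinearMap.compL ℝ (Euc m) (Euc (m + 1)) ℝ (I (N v))).comp (fderiv ℝ (fderiv ℝ F) v)
  have hψapp : ∀ v ∈ Ω, ∀ X Y, ψ v Y X = sff F N v X Y := by
    intro v hv X Y
    rw [h.sff_eq hv, real_inner_comm]
    rfl
  have hψ : ContDiffAt ℝ ∞ ψ u := by
    refine ContDiffAt.clm_comp ?_ (h.contDiffAt_fderiv_fderiv_map hu)
    exact (ContinuousLinearMap.contDiff _).contDiffAt.comp u
      (I.contDiff.contDiffAt.comp u (h.contDiffAt hu))
  have h1le : (1 : WithTop ℕ∞) ≤ ∞ := le_trans one_le_two two_le_infty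
  obtain ⟨C, hC⟩ := exists_norm_le_mul_of_vanish ((h.contDiffAt_jacobian hu).of_le h1le)
    (hψ.of_le h1le) hJ0 hd (by
      filter_upwards [h.mem_nhds hu] with v hv hv0
      ext1 Y
      ext1 X
      rw [hψapp v hv, hII v hv hv0]
      rfl)
  refine ⟨|C|, abs_nonneg C, ?_⟩
  filter_upwards [hC, h.mem_nhds hu] with v hv hvΩ X Y
  rw [← hψapp v hvΩ, ← Real.norm_eq_abs]
  calc ‖ψ v Y X‖ ≤ ‖ψ v‖ * ‖Y‖ * ‖X‖ := (ψ v).le_opNorm₂ Y X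
    _ ≤ |C| * |jacobian F N v| * ‖Y‖ * ‖X‖ := by
      gcongr
      exact hv.trans (by gcongr; exact le_abs_self C)
    _ = _ := by ring

theorem IsCuspidal.exists_abs_curvNum_le (h : IsCuspidal F N Ω u)
    (hII : ∀ v ∈ Ω, jacobian F N v = 0 → ∀ X Y, sff F N v X Y = 0) :
    ∃ C : ℝ, ∀ᶠ v in 𝓝 u, Function.Injective (fderiv ℝ F v) →
      ∀ X Y, |curvNum F N v X Y| ≤ C * gramDet F v X Y := by
  have hn := h.isNormal
  have hu := h.mem
  obtain ⟨η, hη0, hη⟩ := h.null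
  have hηne : η ≠ 0 := by rintro rfl; simp at hη
  have hJ0 := hn.jacobian_eq_zero hu hηne hη0
  have hd : fderiv ℝ (jacobian F N) u ≠ 0 := fun h0 => hη (by rw [h0]; simp)
  obtain ⟨ξ, φ, hξc, hφc, hξ, hξ0, hφ⟩ := hn.exists_null_field hu hη0 hη
  set ζ := ξ u with hζ
  have hζ0 : fderiv ℝ F u ζ = 0 := by rw [hζ, hξ u hu, hJ0, zero_smul]
  have hζJ : fderiv ℝ (jacobian F N) u ζ ≠ 0 := by
    obtain ⟨c, hc⟩ := hn.exists_eq_smul_of_null hu hη0 hη hζ0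
    have hc0 : c ≠ 0 := by rintro rfl; simp [hc] at hξ0
    simp [hc, hc0, hη]
  let θ : Euc m →L[ℝ] ℝ := (‖ζ‖ ^ 2)⁻¹ • innerSL ℝ ζ
  have hθ : θ ζ = 1 := by
    have : ‖ζ‖ ≠ 0 := norm_ne_zero_iff.2 hξ0
    simp [θ, this]
  -- the comparison maps
  let T : Euc m → Euc m →L[ℝ] Euc (m + 1) := fun v =>
    (fderiv ℝ F v).comp (ContinuousLinearMap.id ℝ (Euc m) - θ.smulRight ζ) + θ.smulRight (φ v)
  have hTapp : ∀ v X, T v X = fderiv ℝ F v (X - θ X • ζ) + θ X • φ v := fun v X => rfl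
  have hTc : ContinuousAt T u := by
    refine ContinuousAt.add ?_ ?_
    · exact (hn.contDiffAt_fderiv_map hu).continuousAt.clm_comp continuousAt_const
    · exact ((ContinuousLinearMap.smulRightL ℝ (Euc m) (Euc (m + 1)) θ).continuous.continuousAt).comp
        hφc
  -- At u, T agrees with dF on ker θ, a complement of the null line, and sends ζ to φ(u), which is
  -- outside the image of dF.
  have hTi : Function.Injective (T u) := by
    refine (injective_iff_map_eq_zero _).2 fun X hX => ?_
    rw [hTapp] at hX
    have hθX : θ X = 0 := by
      by_contra hne
      refine hφ (-(θ X)⁻¹ • (X - θ X • ζ)) ?_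
      rw [map_smul, eq_neg_of_add_eq_zero_left hX, smul_neg, neg_smul, neg_neg, smul_smul,
        inv_mul_cancel₀ hne, one_smul]
    rw [hθX, zero_smul, zero_smul, sub_zero, add_zero] at hX
    obtain ⟨c, rfl⟩ := hn.exists_eq_smul_of_null hu hζ0 hζJ hX
    rw [map_smul, hθ, smul_eq_mul, mul_one] at hθX
    rw [hθX, zero_smul]
  obtain ⟨A, hA0, hA⟩ := exists_le_norm_of_injective hTc hTi
  obtain ⟨C, hC0, hC⟩ := hn.exists_abs_sff_le hu hJ0 hd hII
  have hbound : ∀ {E : Type} [NormedAddCommGroup E] {g : Euc m → E}, ContinuousAt g u →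
      ∀ᶠ v in 𝓝 u, ‖g v‖ ≤ ‖g u‖ + 1 := fun {E} _ {g} hg =>
    (hg.norm.eventually (Iio_mem_nhds (lt_add_one _))).mono fun _ hv => le_of_lt hv
  set P := ‖φ u‖ + 1
  set Q := ‖fderiv ℝ N u‖ + 1
  set R := ‖ξ u‖ + 1
  have hP0 : 0 ≤ P := by positivity
  have hQ0 : 0 ≤ Q := by positivity
  have hR0 : 0 ≤ R := by positivity
  have hJ1 : ∀ᶠ v in 𝓝 u, ‖jacobian F N v‖ ≤ 1 := by
    simpa [hJ0] using hbound (hn.differentiableAt_jacobian hu).continuousAt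
  have hθξ : ∀ᶠ v in 𝓝 u, θ (ξ v) ≠ 0 :=
    (θ.continuous.continuousAt.comp hξc).eventually_ne (by simp [← hζ, hθ])
  set A' := (1 + ‖θ‖ * ‖ζ‖) * A
  set A'' := ‖θ‖ * A
  have hA'0 : 0 ≤ A' := by positivity
  have hA''0 : 0 ≤ A'' := by positivity
  set M := C * (A' * A') + P * (Q * A') + P * (Q * R) + A''
  have hM1 : C * (A' * A') ≤ M := by
    have : 0 ≤ P * (Q * A') + P * (Q * R) + A'' := by positivity
    linarith
  have hM2 : P * (Q * A') ≤ M := by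
    have : 0 ≤ C * (A' * A') + P * (Q * R) + A'' := by positivity
    linarith
  have hM3 : P * (Q * R) ≤ M := by
    have : 0 ≤ C * (A' * A') + P * (Q * A') + A'' := by positivity
    linarith
  have hM4 : A'' ≤ M := by
    have : 0 ≤ C * (A' * A') + P * (Q * A') + P * (Q * R) := by positivity
    linarith
  refine ⟨2 * M ^ 2 + 8 * M ^ 3 + 8 * M ^ 4, ?_⟩
  filter_upwards [hn.mem_nhds hu, hA, hC, hbound hφc,
    hbound (hn.contDiffAt_fderiv hu).continuousAt, hbound hξc, hJ1, hθξ]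
    with v hv hAv hCv hφv hNv hξv hJv hθv hinj
  refine abs_curvNum_le_gramDet hn hv fun X Y => ?_
  set J := jacobian F N v with hJ
  have hJne : J ≠ 0 := (hn.jacobian_ne_zero_iff hv).2 hinj
  have hdec : ∀ X, ∃ (X' : Euc m) (a : ℝ), X = X' + a • ξ v ∧
      ‖X'‖ ≤ A' * ‖fderiv ℝ F v X‖ ∧ |a * J| ≤ A'' * ‖fderiv ℝ F v X‖ := by
    intro X
    set a := θ X / θ (ξ v) with ha
    set X' := X - a • ξ v with hX'
    have hθX' : θ X' = 0 := by
      rw [hX', map_sub, map_smul, smul_eq_mul, ha, div_mul_cancel₀ _ hθv, sub_self]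
    -- Replacing aξ by aλζ gives T(Z) = dF(X') + aλφ = dF(X), so the uniform injectivity of T bounds
    -- X' and aλ together, although a itself may blow up.
    set Z := X' + (a * J) • ζ with hZ
    have hθZ : θ Z = a * J := by
      rw [hZ, map_add, map_smul, hθX', hθ, zero_add, smul_eq_mul, mul_one]
    have hTZ : T v Z = fderiv ℝ F v X := by
      rw [hTapp, hθZ, hZ, add_sub_cancel_right, mul_smul, ← hξ v hv, ← map_smul, ← map_add, hX',
        sub_add_cancel]
    have hZA : ‖Z‖ ≤ A * ‖fderiv ℝ F v X‖ := hTZ ▸ hAv Z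
    have haJ : |a * J| ≤ A'' * ‖fderiv ℝ F v X‖ := by
      rw [← hθZ, ← Real.norm_eq_abs]
      calc ‖θ Z‖ ≤ ‖θ‖ * ‖Z‖ := θ.le_opNorm Z
        _ ≤ ‖θ‖ * (A * ‖fderiv ℝ F v X‖) := by gcongr
        _ = _ := by ring
    refine ⟨X', a, by rw [hX', sub_add_cancel], ?_, haJ⟩
    have hX'Z : X' = Z - (a * J) • ζ := by rw [hZ, add_sub_cancel_right]
    calc ‖X'‖ ≤ ‖Z‖ + |a * J| * ‖ζ‖ := by
          rw [hX'Z, ← Real.norm_eq_abs, ← norm_smul]; exact norm_sub_le _ _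
      _ ≤ A * ‖fderiv ℝ F v X‖ + (A'' * ‖fderiv ℝ F v X‖) * ‖ζ‖ := by gcongr
      _ = _ := by ring
  obtain ⟨X', a, hXe, hX', ha⟩ := hdec X
  obtain ⟨Y', b, hYe, hY', hb⟩ := hdec Y
  set x := ‖fderiv ℝ F v X‖
  set y := ‖fderiv ℝ F v Y‖
  have hx : 0 ≤ x := norm_nonneg _
  have hy : 0 ≤ y := norm_nonneg _
  have hk : ∀ {S T : Euc m} {s t : ℝ}, 0 ≤ s → 0 ≤ t → ‖S‖ ≤ A' * s → ‖T‖ ≤ A' * t →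
      |sff F N v S T / J| ≤ M * (s * t) := by
    intro S T s t hs ht hS hT
    rw [abs_div, div_le_iff₀ (abs_pos.2 hJne)]
    calc |sff F N v S T| ≤ C * |J| * (‖S‖ * ‖T‖) := hCv S T
      _ ≤ C * |J| * ((A' * s) * (A' * t)) := by gcongr
      _ = C * (A' * A') * (s * t) * |J| := by ring
      _ ≤ M * (s * t) * |J| := by gcongr
  have hl : ∀ {S : Euc m} {s : ℝ}, 0 ≤ s → ‖S‖ ≤ A' * s →
      |-inner ℝ (φ v) (fderiv ℝ N v S)| ≤ M * s := by
    intro S s hs hS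
    rw [abs_neg]
    calc |inner ℝ (φ v) (fderiv ℝ N v S)| ≤ ‖φ v‖ * ‖fderiv ℝ N v S‖ := abs_real_inner_le_norm _ _
      _ ≤ P * (Q * (A' * s)) := by
        gcongr
        exact ((fderiv ℝ N v).le_opNorm S).trans (by gcongr)
      _ = P * (Q * A') * s := by ring
      _ ≤ M * s := by gcongr
  have hc : |-inner ℝ (φ v) (fderiv ℝ N v (ξ v))| ≤ M := by
    rw [abs_neg]
    calc |inner ℝ (φ v) (fderiv ℝ N v (ξ v))| ≤ ‖φ v‖ * ‖fderiv ℝ N v (ξ v)‖ :=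
          abs_real_inner_le_norm _ _
      _ ≤ P * (Q * R) := by
        gcongr
        exact ((fderiv ℝ N v).le_opNorm _).trans (by gcongr)
      _ ≤ M := hM3
  have hξsff : ∀ S, sff F N v (ξ v) S = J * -inner ℝ (φ v) (fderiv ℝ N v S) := by
    intro S
    rw [sff, hξ v hv, inner_smul_left]
    simp [hJ]
  -- A factor λ splits off from II: on S, T because II = O(λ), and on any pair containing ξ because
  -- dF(ξ) = λφ.
  have hexp : ∀ (S T : Euc m) (s t : ℝ), sff F N v (S + s • ξ v) (T + t • ξ v) =
      J * (sff F N v S T / J + t * -inner ℝ (φ v) (fderiv ℝ N v S) +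
        s * -inner ℝ (φ v) (fderiv ℝ N v T) + s * t * -inner ℝ (φ v) (fderiv ℝ N v (ξ v))) := by
    intro S T s t
    have h1 : sff F N v (S + s • ξ v) (T + t • ξ v) = sff F N v S T + t * sff F N v S (ξ v) +
        s * sff F N v (ξ v) T + s * t * sff F N v (ξ v) (ξ v) := by
      simp only [sff, map_add, map_smul, inner_add_left, inner_add_right, inner_smul_left,
        inner_smul_right, RCLike.conj_to_real]
      ring
    rw [h1, hn.sff_symm hv S (ξ v), hξsff, hξsff, hξsff]
    field_simp
  have hmain := abs_gauss_numerator_le hx hy (by simpa using hJv) (ha.trans (by gcongr))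
    (hb.trans (by gcongr)) hc (hk hx hx hX' hX') (hk hx hy hX' hY') (hk hy hy hY' hY')
    (hl hx hX') (hl hy hY')
  refine le_trans (le_of_eq ?_) hmain
  congr 1
  rw [curvNum, hXe, hYe, hexp, hexp, hexp]
  ring

end CuspidalCurvature

/-! ### Passage between the manifold and a fixed preferred chart. -/

section ChartTransfer

variable {m : ℕ} {M : Type*} [TopologicalSpace M] [ChartedSpace (Euc m) M]

/-- The differential at `q` of the preferred chart at `p`. -/
noncomputable def chartDifferential (p q : M) : Euc m →L[ℝ] Euc m :=
  mfderiv (𝓡 m) 𝓘(ℝ, Euc m) (extChartAt (𝓡 m) p) q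

variable {f ν : M → Euc (m + 1)} {V : Set M} {p q : M}

/-- If dλ vanished on ker dF, transversality would force ker dλ to be everything, contradicting dλ ≠
0. -/
theorem IsA2Point.exists_null (hp : IsA2Point f p) :
    ∃ (V : Set M) (ν : M → Euc (m + 1)), IsOpen V ∧ p ∈ V ∧ IsUnitNormalOn f ν V ∧
      ∃ η, fderiv ℝ (chartRep f p) (coordAt p) η = 0 ∧
        fderiv ℝ (jacobian (chartRep f p) (chartRep ν p)) (coordAt p) η ≠ 0 := by
  obtain ⟨-, V, ν, hV, hpV, hν, hd, htop⟩ := hp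
  refine ⟨V, ν, hV, hpV, hν, ?_⟩
  by_contra! hcon
  apply hd
  have hle : LinearMap.ker (fderiv ℝ (chartRep f p) (coordAt p) : Euc m →ₗ[ℝ] Euc (m + 1)) ≤
      singularTangent (chartRep f p) (chartRep ν p) (coordAt p) := fun x hx => hcon x hx
  rw [sup_eq_right.2 hle] at htop
  ext1 x
  have hx : x ∈ singularTangent (chartRep f p) (chartRep ν p) (coordAt p) := htop ▸ trivial
  exact hx

variable [IsManifold (𝓡 m) ∞ M]

theorem bijective_chartDifferential (hq : q ∈ (extChartAt (𝓡 m) p).source) :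
    Function.Bijective (chartDifferential (m := m) p q) := by
  have : IsManifold (𝓡 m) 1 M := IsManifold.of_le (n := ∞) (by simp)
  obtain ⟨e, he⟩ := isInvertible_mfderiv_extChartAt (I := 𝓡 m) hq
  have h : ⇑(chartDifferential p q) = e := congrArg DFunLike.coe he.symm
  rw [h]
  exact e.bijective

theorem chartDifferential_self (p : M) :
    chartDifferential p p = ContinuousLinearMap.id ℝ (Euc m) := by
  have : IsManifold (𝓡 m) 1 M := IsManifold.of_le (n := ∞) (by simp)
  exact mfderiv_extChartAt_self

theorem contDiffAt_comp_extChartAt_symm {E : Type*} [NormedAddCommGroup E] [NormedSpace ℝ E]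
    {h : M → E} {p : M} {u : Euc m} (hu : u ∈ (extChartAt (𝓡 m) p).target)
    (hh : ContMDiffAt (𝓡 m) 𝓘(ℝ, E) ∞ h ((extChartAt (𝓡 m) p).symm u)) :
    ContDiffAt ℝ ∞ (h ∘ (extChartAt (𝓡 m) p).symm) u :=
  contMDiffAt_iff_contDiffAt.1 (hh.comp u ((contMDiffOn_extChartAt_symm p).contMDiffAt
    ((isOpen_extChartAt_target p).mem_nhds hu)))

theorem mfderiv_eq_fderiv_comp {E : Type*} [NormedAddCommGroup E] [NormedSpace ℝ E]
    {h : M → E} {p q : M} (hq : q ∈ (extChartAt (𝓡 m) p).source)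
    (hh : ContMDiffAt (𝓡 m) 𝓘(ℝ, E) ∞ h q) (X : Euc m) :
    (mfderiv (𝓡 m) 𝓘(ℝ, E) h q : Euc m →L[ℝ] E) X =
      fderiv ℝ (h ∘ (extChartAt (𝓡 m) p).symm) (extChartAt (𝓡 m) p q)
        (chartDifferential p q X) := by
  have : IsManifold (𝓡 m) 1 M := IsManifold.of_le (n := ∞) (by simp)
  have hev : h =ᶠ[𝓝 q] (h ∘ (extChartAt (𝓡 m) p).symm) ∘ extChartAt (𝓡 m) p := by
    filter_upwards [extChartAt_source_mem_nhds' hq] with x hx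
    exact (congrArg h ((extChartAt (𝓡 m) p).left_inv hx)).symm
  have hd : DifferentiableAt ℝ (h ∘ (extChartAt (𝓡 m) p).symm) (extChartAt (𝓡 m) p q) :=
    (contDiffAt_comp_extChartAt_symm ((extChartAt (𝓡 m) p).map_source hq)
      (by rwa [(extChartAt (𝓡 m) p).left_inv hq])).differentiableAt (by simp)
  have hc := mfderiv_comp (I := 𝓡 m) (I' := 𝓘(ℝ, Euc m)) (I'' := 𝓘(ℝ, E)) q
    hd.mdifferentiableAt
    (mdifferentiableAt_extChartAt (I := 𝓡 m) (by rwa [extChartAt_source] at hq))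
  rw [hev.mfderiv_eq, hc, mfderiv_eq_fderiv]
  rfl

theorem differential_eq {h : M → Euc (m + 1)} (hq : q ∈ (extChartAt (𝓡 m) p).source)
    (hh : ContMDiffAt (𝓡 m) 𝓘(ℝ, Euc (m + 1)) ∞ h q) (X : Euc m) :
    differential h q X =
      fderiv ℝ (chartRep h p) (extChartAt (𝓡 m) p q) (chartDifferential p q X) :=
  mfderiv_eq_fderiv_comp hq hh X

theorem injective_fderiv_chartRep_iff (hf : ContMDiff (𝓡 m) 𝓘(ℝ, Euc (m + 1)) ∞ f)
    (hq : q ∈ (extChartAt (𝓡 m) p).source) :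
    Function.Injective (fderiv ℝ (chartRep f p) (extChartAt (𝓡 m) p q)) ↔ q ∉ singularSet f := by
  have h1 : ⇑(differential f q) =
      fderiv ℝ (chartRep f p) (extChartAt (𝓡 m) p q) ∘ chartDifferential p q :=
    funext fun X => differential_eq hq (hf q) X
  have hb := bijective_chartDifferential hq
  rw [singularSet, Set.mem_ofPred_eq, not_not, h1]
  exact (Function.Injective.of_comp_iff' _ hb).symm

theorem IsUnitNormalOn.isNormalAlong (h : IsUnitNormalOn f ν V)
    (hf : ContMDiff (𝓡 m) 𝓘(ℝ, Euc (m + 1)) ∞ f) (hV : IsOpen V) (p : M) :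
    IsNormalAlong (chartRep f p) (chartRep ν p)
      ((extChartAt (𝓡 m) p).target ∩ (extChartAt (𝓡 m) p).symm ⁻¹' V) where
  isOpen := (continuousOn_extChartAt_symm p).isOpen_inter_preimage (isOpen_extChartAt_target p) hV
  smooth_map u hu := (contDiffAt_comp_extChartAt_symm hu.1 (hf _)).contDiffWithinAt
  smooth u hu := (contDiffAt_comp_extChartAt_symm hu.1
    (h.smooth.contMDiffAt (hV.mem_nhds hu.2))).contDiffWithinAt
  norm_eq u hu := h.norm_eq _ hu.2
  normal u hu X := by
    have hs := (extChartAt (𝓡 m) p).map_target hu.1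
    obtain ⟨Y, rfl⟩ := (bijective_chartDifferential hs).2 X
    have h1 := h.normal _ hu.2 Y
    rw [differential_eq hs (hf _), (extChartAt (𝓡 m) p).right_inv hu.1] at h1
    exact h1

theorem IsUnitNormalOn.secondForm_eq (h : IsUnitNormalOn f ν V)
    (hf : ContMDiff (𝓡 m) 𝓘(ℝ, Euc (m + 1)) ∞ f) (hV : IsOpen V) (hqV : q ∈ V)
    (hq : q ∈ (extChartAt (𝓡 m) p).source) (X Y : Euc m) :
    secondForm f ν q X Y = sff (chartRep f p) (chartRep ν p) (extChartAt (𝓡 m) p q)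
      (chartDifferential p q X) (chartDifferential p q Y) := by
  change -inner ℝ (differential f q X) (differential ν q Y) = _
  rw [sff, differential_eq hq (hf q),
    differential_eq hq (h.smooth.contMDiffAt (hV.mem_nhds hqV))]

/-- The Gauss equation, read in an arbitrary preferred chart. -/
theorem IsUnitNormalOn.sectionalCurvature_eq (h : IsUnitNormalOn f ν V)
    (hf : ContMDiff (𝓡 m) 𝓘(ℝ, Euc (m + 1)) ∞ f) (hV : IsOpen V) (hqV : q ∈ V)
    (hq : q ∈ (extChartAt (𝓡 m) p).source) (hreg : q ∉ singularSet f) (X Y : Euc m) :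
    sectionalCurvature f q X Y =
      curvNum (chartRep f p) (chartRep ν p) (extChartAt (𝓡 m) p q)
        (chartDifferential p q X) (chartDifferential p q Y) /
      gramDet (chartRep f p) (extChartAt (𝓡 m) p q)
        (chartDifferential p q X) (chartDifferential p q Y) := by
  have hqs := mem_extChartAt_source (I := 𝓡 m) q
  have hn := h.isNormalAlong hf hV q
  have hmem : coordAt q ∈ (extChartAt (𝓡 m) q).target ∩ (extChartAt (𝓡 m) q).symm ⁻¹' V :=
    ⟨mem_extChartAt_target q, by simpa [coordAt] using hqV⟩
  have h1 := hn.sectional_eq hmem ((injective_fderiv_chartRep_iff hf hqs).2 hreg) X Y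
  -- The curvature at q is computed in the chart at q. After the Gauss equation only II and df
  -- occur, which are defined without charts and can be read in the chart at p.
  have hsff : ∀ X Y, sff (chartRep f q) (chartRep ν q) (coordAt q) X Y =
      sff (chartRep f p) (chartRep ν p) (extChartAt (𝓡 m) p q)
      (chartDifferential p q X) (chartDifferential p q Y) := by
    intro X Y
    rw [← h.secondForm_eq hf hV hqV hq, h.secondForm_eq hf hV hqV hqs, chartDifferential_self]
    rfl
  have hdF : ∀ X, fderiv ℝ (chartRep f q) (coordAt q) X =
      fderiv ℝ (chartRep f p) (extChartAt (𝓡 m) p q) (chartDifferential p q X) := by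
    intro X
    rw [← differential_eq hq (hf q), differential_eq hqs (hf q), chartDifferential_self]
    rfl
  rw [hsff, hsff, hsff, hdF, hdF] at h1
  exact h1

/-- The domains of three unit normals are intersected: the given one, that of the A₂ condition and
that of the front condition. Staying inside U keeps the curvature hypothesis available on Ω. -/
theorem IsA2Point.exists_isCuspidal (hp : IsA2Point f p) (hf : IsWaveFront f)
    {U : Set M} (hU : IsOpen U) (hpU : p ∈ U) (hV : IsOpen V) (hpV : p ∈ V)
    (hν : IsUnitNormalOn f ν V) :
    ∃ Ω ⊆ (extChartAt (𝓡 m) p).target ∩ (extChartAt (𝓡 m) p).symm ⁻¹' (V ∩ U),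
      IsCuspidal (chartRep f p) (chartRep ν p) Ω (coordAt p) := by
  obtain ⟨V', ν', hV', hpV', hν', hnull⟩ := hp.exists_null
  obtain ⟨V'', ν'', hV'', hpV'', hν'', himm⟩ := hf.2 p
  have hs := mem_extChartAt_source (I := 𝓡 m) p
  set W := V ∩ U ∩ V' ∩ V'' with hW
  have hWo : IsOpen W := ((hV.inter hU).inter hV').inter hV''
  set Ω := (extChartAt (𝓡 m) p).target ∩ (extChartAt (𝓡 m) p).symm ⁻¹' W with hΩ
  have hΩo : IsOpen Ω :=
    (continuousOn_extChartAt_symm p).isOpen_inter_preimage (isOpen_extChartAt_target p) hWo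
  have hmem : coordAt p ∈ Ω :=
    ⟨mem_extChartAt_target p, by simpa [coordAt] using ⟨⟨⟨hpV, hpU⟩, hpV'⟩, hpV''⟩⟩
  have hsub : ∀ {A : Set M}, W ⊆ A →
      Ω ⊆ (extChartAt (𝓡 m) p).target ∩ (extChartAt (𝓡 m) p).symm ⁻¹' A :=
    fun h u hu => ⟨hu.1, h hu.2⟩
  refine ⟨Ω, hsub fun x hx => hx.1.1, ?_⟩
  refine ((hν.isNormalAlong hf.1 hV p).mono hΩo (hsub fun x hx => hx.1.1.1)).isCuspidal
    ((hν'.isNormalAlong hf.1 hV' p).mono hΩo (hsub fun x hx => hx.1.2))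
    ((hν''.isNormalAlong hf.1 hV'' p).mono hΩo (hsub fun x hx => hx.2)) hmem hnull ?_
  intro X hX hNX
  have hsm : ContMDiffAt (𝓡 m) 𝓘(ℝ, Euc (m + 1)) ∞ ν'' p :=
    hν''.smooth.contMDiffAt (hV''.mem_nhds hpV'')
  have htar := mem_extChartAt_target (I := 𝓡 m) p
  have hinv : (extChartAt (𝓡 m) p).symm (extChartAt (𝓡 m) p p) = p :=
    (extChartAt (𝓡 m) p).left_inv hs
  have hF : DifferentiableAt ℝ (chartRep f p) (coordAt p) :=
    (contDiffAt_comp_extChartAt_symm htar (hf.1 _)).differentiableAt (by simp)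
  have hN : DifferentiableAt ℝ (chartRep ν'' p) (coordAt p) :=
    (contDiffAt_comp_extChartAt_symm htar (by rwa [hinv])).differentiableAt (by simp)
  have h1 := mfderiv_eq_fderiv_comp hs ((hf.1 p).prodMk_space hsm) X
  rw [chartDifferential_self] at h1
  have h2 : fderiv ℝ ((fun x => (f x, ν'' x)) ∘ (extChartAt (𝓡 m) p).symm) (coordAt p) X = 0 := by
    have h3 : ((fun x => (f x, ν'' x)) ∘ (extChartAt (𝓡 m) p).symm) =
      fun u => (chartRep f p u, chartRep ν'' p u) := rfl
    rw [h3, hF.fderiv_prodMk hN]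
    simp [hX, hNX]
  have h4 := h1.trans h2
  exact himm p hpV'' (h4.trans (map_zero _).symm)

end ChartTransfer

/-! ### The curvature hypotheses in a chart, and the conclusions on the manifold. -/

section Curvature

variable {m : ℕ}

/-- Sectional curvature is controlled only on planes; with this the inequalities extend to all pairs
X, Y, as the differentiation arguments require. -/
theorem curvNum_eq_zero_of_dependent (F N : Euc m → Euc (m + 1)) (u : Euc m) {X Y : Euc m}
    (hXY : ¬ LinearIndependent ℝ ![X, Y]) :
    curvNum F N u X Y = 0 ∧ gramDet F u X Y = 0 := by
  by_cases hX : X = 0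
  · simp [curvNum, gramDet, sff, hX]
  · rw [LinearIndependent.pair_iff' hX] at hXY
    push Not at hXY
    obtain ⟨a, rfl⟩ := hXY
    simp only [curvNum, gramDet, sff, map_smul, inner_smul_left, inner_smul_right,
      RCLike.conj_to_real]
    constructor <;> ring

theorem gramDet_pos {F : Euc m → Euc (m + 1)} {u : Euc m}
    (hi : Function.Injective (fderiv ℝ F u)) {X Y : Euc m} (hXY : LinearIndependent ℝ ![X, Y]) :
    0 < gramDet F u X Y := by
  have hX : X ≠ 0 := hXY.ne_zero 0
  rw [LinearIndependent.pair_iff' hX] at hXY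
  have hx : fderiv ℝ F u X ≠ 0 := fun h0 => hX (hi (by rw [h0, map_zero]))
  rw [gramDet_eq_mul hx]
  refine mul_pos (pow_pos (norm_pos_iff.2 hx) 2) (pow_pos (norm_pos_iff.2 fun h0 => ?_) 2)
  exact hXY _ (sub_eq_zero.1 (hi (by rw [h0, map_zero]))).symm

variable {M : Type*} [TopologicalSpace M] [ChartedSpace (Euc m) M] [IsManifold (𝓡 m) ∞ M]
  {f ν : M → Euc (m + 1)} {U V : Set M} {p : M}

theorem IsUnitNormalOn.curvNum_add_nonneg (hν : IsUnitNormalOn f ν V)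
    (hf : ContMDiff (𝓡 m) 𝓘(ℝ, Euc (m + 1)) ∞ f) (hV : IsOpen V) {C : ℝ}
    (hK : ∀ q ∈ U \ singularSet f, ∀ X Y : TangentSpace (𝓡 m) q,
      LinearIndependent ℝ ![X, Y] → -C ≤ sectionalCurvature f q X Y) {u : Euc m}
    (hu : u ∈ (extChartAt (𝓡 m) p).target ∩ (extChartAt (𝓡 m) p).symm ⁻¹' (V ∩ U))
    (hi : Function.Injective (fderiv ℝ (chartRep f p) u)) (X Y : Euc m) :
    0 ≤ curvNum (chartRep f p) (chartRep ν p) u X Y + C * gramDet (chartRep f p) u X Y := by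
  by_cases hXY : LinearIndependent ℝ ![X, Y]
  · have hs := (extChartAt (𝓡 m) p).map_target hu.1
    have hinv := (extChartAt (𝓡 m) p).right_inv hu.1
    have hreg := (injective_fderiv_chartRep_iff hf hs).1 (by rwa [hinv])
    obtain ⟨X', rfl⟩ := (bijective_chartDifferential hs).2 X
    obtain ⟨Y', rfl⟩ := (bijective_chartDifferential hs).2 Y
    have hXY' : LinearIndependent ℝ ![X', Y'] := by
      refine LinearIndependent.of_comp (chartDifferential (m := m) p ((extChartAt (𝓡 m) p).symm u)).toLinearMap ?_
      convert hXY using 1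
      ext1 i
      fin_cases i <;> rfl
    have h1 := hK _ ⟨hu.2.2, hreg⟩ X' Y' hXY'
    rw [hν.sectionalCurvature_eq hf hV hu.2.1 hs hreg, hinv, le_div_iff₀ (gramDet_pos hi hXY)] at h1
    linarith
  · have h1 := curvNum_eq_zero_of_dependent (chartRep f p) (chartRep ν p) u hXY
    rw [h1.1, h1.2, mul_zero, add_zero]

/-- If the sectional curvature is bounded from below, then the second fundamental form vanishes on
the singular set. -/
theorem secondForm_eq_zero (hf : IsWaveFront f) (hU : IsOpen U)
    (hA : ∀ p ∈ U ∩ singularSet f, IsA2Point f p) {C : ℝ}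
    (hK : ∀ q ∈ U \ singularSet f, ∀ X Y : TangentSpace (𝓡 m) q,
      LinearIndependent ℝ ![X, Y] → -C ≤ sectionalCurvature f q X Y)
    (hp : p ∈ U ∩ singularSet f) (hV : IsOpen V) (hpV : p ∈ V) (hν : IsUnitNormalOn f ν V)
    (X Y : TangentSpace (𝓡 m) p) : secondForm f ν p X Y = 0 := by
  obtain ⟨Ω, hΩ, hc⟩ := (hA p hp).exists_isCuspidal hf hU hp.1 hV hpV hν
  refine (hν.secondForm_eq hf.1 hV hpV (mem_extChartAt_source p) X Y).trans ?_
  exact hc.sff_eq_zero (fun v hv hi => hν.curvNum_add_nonneg hf.1 hV hK (hΩ hv) hi) _ _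

theorem IsUnitNormalOn.exists_sectionalCurvature_le (hν : IsUnitNormalOn f ν V)
    (hf : ContMDiff (𝓡 m) 𝓘(ℝ, Euc (m + 1)) ∞ f) (hV : IsOpen V) (hpV : p ∈ V) {C : ℝ}
    (hC : ∀ᶠ u in 𝓝 (coordAt p), Function.Injective (fderiv ℝ (chartRep f p) u) → ∀ X Y,
      |curvNum (chartRep f p) (chartRep ν p) u X Y| ≤ C * gramDet (chartRep f p) u X Y) :
    ∃ S ∈ 𝓝 p, ∃ C : ℝ, ∀ q ∈ (S ∩ U) \ singularSet f, ∀ X Y : TangentSpace (𝓡 m) q,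
      LinearIndependent ℝ ![X, Y] → |sectionalCurvature f q X Y| ≤ C := by
  refine ⟨_, inter_mem (inter_mem ((continuousAt_extChartAt (I := 𝓡 m) p).eventually hC)
    (extChartAt_source_mem_nhds (I := 𝓡 m) p)) (hV.mem_nhds hpV), |C|, ?_⟩
  rintro q ⟨⟨⟨⟨hq, hs⟩, hqV⟩, -⟩, hreg⟩ X Y -
  have hi := (injective_fderiv_chartRep_iff hf hs).2 hreg
  have hK := hν.sectionalCurvature_eq hf hV hqV hs hreg X Y
  rw [hK, abs_div, abs_of_nonneg (gramDet_nonneg _ _ _ _)]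
  refine div_le_of_le_mul₀ (gramDet_nonneg _ _ _ _) (abs_nonneg C) ((hq hi _ _).trans ?_)
  exact mul_le_mul_of_nonneg_right (le_abs_self C) (gramDet_nonneg _ _ _ _)

theorem exists_sectionalCurvature_le (hf : IsWaveFront f) (hU : IsOpen U)
    (hA : ∀ p ∈ U ∩ singularSet f, IsA2Point f p) {C : ℝ}
    (hK : ∀ q ∈ U \ singularSet f, ∀ X Y : TangentSpace (𝓡 m) q,
      LinearIndependent ℝ ![X, Y] → -C ≤ sectionalCurvature f q X Y) (hp : p ∈ U) :
    ∃ S ∈ 𝓝 p, ∃ C : ℝ, ∀ q ∈ (S ∩ U) \ singularSet f, ∀ X Y : TangentSpace (𝓡 m) q,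
      LinearIndependent ℝ ![X, Y] → |sectionalCurvature f q X Y| ≤ C := by
  obtain ⟨V, ν, hV, hpV, hν, -⟩ := hf.2 p
  by_cases hsing : p ∈ singularSet f
  · obtain ⟨Ω, hΩ, hc⟩ := (hA p ⟨hp, hsing⟩).exists_isCuspidal hf hU hp hV hpV hν
    obtain ⟨C', hC'⟩ := hc.exists_abs_curvNum_le (by
      intro u hu hu0 X Y
      have hs := (extChartAt (𝓡 m) p).map_target (hΩ hu).1
      have hinv := (extChartAt (𝓡 m) p).right_inv (hΩ hu).1
      -- Zeros of λ in Ω are singular points in U, hence A₂-points, where II is already known to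
      -- vanish.
      have hqs : (extChartAt (𝓡 m) p).symm u ∈ singularSet f := by
        by_contra hreg
        rw [← injective_fderiv_chartRep_iff hf.1 hs, hinv, ← hc.isNormal.jacobian_ne_zero_iff hu]
          at hreg
        exact hreg hu0
      obtain ⟨X', rfl⟩ := (bijective_chartDifferential hs).2 X
      obtain ⟨Y', rfl⟩ := (bijective_chartDifferential hs).2 Y
      have h1 := secondForm_eq_zero hf hU hA hK ⟨(hΩ hu).2.2, hqs⟩ hV (hΩ hu).2.1 hν X' Y'
      rwa [hν.secondForm_eq hf.1 hV (hΩ hu).2.1 hs, hinv] at h1)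
    exact hν.exists_sectionalCurvature_le hf.1 hV hpV hC'
  · have hi := (injective_fderiv_chartRep_iff hf.1 (mem_extChartAt_source p)).2 hsing
    have hmem : coordAt p ∈ (extChartAt (𝓡 m) p).target ∩ (extChartAt (𝓡 m) p).symm ⁻¹' V :=
      ⟨mem_extChartAt_target p, by simpa [coordAt] using hpV⟩
    obtain ⟨C', hC'⟩ := (hν.isNormalAlong hf.1 hV p).exists_abs_curvNum_le hmem hi
    exact hν.exists_sectionalCurvature_le hf.1 hV hpV (hC'.mono fun u hu _ => hu)

theorem IsSingularPrincipalCurvature.nonpos (hf : IsWaveFront f) (hU : IsOpen U)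
    (hA : ∀ p ∈ U ∩ singularSet f, IsA2Point f p)
    (hK : ∀ q ∈ U \ singularSet f, ∀ X Y : TangentSpace (𝓡 m) q,
      LinearIndependent ℝ ![X, Y] → 0 ≤ sectionalCurvature f q X Y)
    (hp : p ∈ U ∩ singularSet f) {κ : ℝ} (hκ : IsSingularPrincipalCurvature f p κ) : κ ≤ 0 := by
  obtain ⟨V, ν, hV, hpV, hν, W, hW, hpW, -, S, ⟨e, n, η, hfr, hη0, hpos, hS⟩, heig⟩ := hκ
  obtain ⟨Ω, hΩ, hc⟩ := (hA p hp).exists_isCuspidal hf hU hp.1 hV hpV hν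
  obtain ⟨X, hX⟩ := heig.exists_hasEigenvector
  have hK' : ∀ v ∈ Ω, Function.Injective (fderiv ℝ (chartRep f p) v) → ∀ X Y,
      0 ≤ curvNum (chartRep f p) (chartRep ν p) v X Y + 0 * gramDet (chartRep f p) v X Y :=
    fun v hv hi => hν.curvNum_add_nonneg hf.1 hV (by simpa using hK) (hΩ hv) hi
  refine hc.singular_curvature_nonpos (hc.sff_eq_zero hK') (by simpa using hK') hW hpW hfr hη0 hpos
    (X := X) X.2 (fun h0 => hX.2 (Subtype.ext h0)) ?_
  rw [← hS X, hX.apply_eq_smul]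
  rfl

end Curvature

end WaveFront

theorem mainTheorem2 {m : ℕ} {M : Type*} [TopologicalSpace M]
    [ChartedSpace (EuclideanSpace ℝ (Fin m)) M] [IsManifold (𝓡 m) ∞ M]
    (f : M → EuclideanSpace ℝ (Fin (m + 1))) (hf : WaveFront.IsWaveFront f)
    (U : Set M) (hU : IsOpen U)
    (hA : ∀ p ∈ U ∩ WaveFront.singularSet f, WaveFront.IsA2Point f p) :
    ((∃ C : ℝ, ∀ q ∈ U \ WaveFront.singularSet f, ∀ X Y : TangentSpace (𝓡 m) q,
        LinearIndependent ℝ ![X, Y] → |WaveFront.sectionalCurvature f q X Y| ≤ C) →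
      ∀ p ∈ U ∩ WaveFront.singularSet f, ∀ (V : Set M) (ν : M → EuclideanSpace ℝ (Fin (m + 1))),
        IsOpen V → p ∈ V → WaveFront.IsUnitNormalOn f ν V →
        ∀ X Y : TangentSpace (𝓡 m) p, WaveFront.secondForm f ν p X Y = 0) ∧
    ((∀ q ∈ U \ WaveFront.singularSet f, ∀ X Y : TangentSpace (𝓡 m) q,
        LinearIndependent ℝ ![X, Y] → 0 ≤ WaveFront.sectionalCurvature f q X Y) →
      (∀ p ∈ U, ∃ V ∈ 𝓝 p, ∃ C : ℝ, ∀ q ∈ (V ∩ U) \ WaveFront.singularSet f,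
        ∀ X Y : TangentSpace (𝓡 m) q,
          LinearIndependent ℝ ![X, Y] → |WaveFront.sectionalCurvature f q X Y| ≤ C) ∧
      ∀ p ∈ U ∩ WaveFront.singularSet f, ∀ κ : ℝ,
        WaveFront.IsSingularPrincipalCurvature f p κ → κ ≤ 0) := by
  refine ⟨?_, fun hK => ⟨fun p hp => ?_, fun p hp κ hκ => ?_⟩⟩
  · rintro ⟨C, hC⟩ p hp V ν hV hpV hν X Y
    exact WaveFront.secondForm_eq_zero hf hU hA (C := C)
      (fun q hq X Y hXY => (abs_le.1 (hC q hq X Y hXY)).1) hp hV hpV hν X Y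
  · exact WaveFront.exists_sectionalCurvature_le hf hU hA (C := 0) (by simpa using hK) hp
  · exact hκ.nonpos hf hU hA hK hp
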